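/- Let $\gamma,\lambda,\mu>0$ and let $Q=H^1(\mathbb R^+)\oplus H^1(\mathbb R^-)$ be the space of complex-valued functions on $\mathbb R$ whose restrictions to the two open half-lines are in $H^1$, with norm $\|\psi\|_Q^2=\|\psi\|_2^2+\|\psi'\|_2^2$, where $\psi'$ is the derivative away from the origin. For $\omega\in\mathbb R$ and $\psi\in Q$, with boundary values $\psi(0\pm)$, put $$S_\omega(\psi)=\tfrac12\|\psi'\|_2^2-\tfrac1{2\gamma}|\psi(0+)-\psi(0-)|^2+\tfrac\omega2\|\psi\|_2^2-\tfrac{\lambda}{2\mu+2}\|\psi\|_{2\mu+2}^{2\mu+2},$$ $$I_\omega(\psi)=\|\psi'\|_2^2-\tfrac1\gamma|\psi(0+)-\psi(0-)|^2+\omega\|\psi\|_2^2-\lambda\|\psi\|_{2\mu+2}^{2\mu+2},\qquad \widetilde S(\psi)=\tfrac{\lambda\mu}{2(\mu+1)}\|\psi\|_{2\mu+2}^{2\mu+2},$$ $$d(\omega)=\inf\{S_\omega(\psi):\psi\in Q\setminus\{0\},\ I_\omega(\psi)=0\}.$$ **Theorem.** Let $\omega>4/\gamma^2$. 1. There is $\psi\in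 Q\setminus\{0\}$ with $I_\omega(\psi)=0$ and $S_\omega(\psi)=d(\omega)$; thus $\psi$ minimizes $S_\omega$ on the Nehari manifold $\{\varphi\in Q\setminus\{0\}: I_\omega(\varphi)=0\}$. Moreover $\psi$ minimizes $\widetilde S$ on $\{\varphi\in Q\setminus\{0\}: I_\omega(\varphi)\le 0\}$. 2. If $(\psi_n)$ is a minimizing sequence for $S_\omega$ on $\{\varphi\in Q\setminus\{0\}: I_\omega(\varphi)=0\}$, or a minimizing sequence for $\widetilde S$ on $\{\varphi\in Q\setminus\{0\}: I_\omega(\varphi)\le0\}$, and $(\psi_n)$ converges weakly in $Q$ to some $\psi_\infty\in Q$, then $\psi_n\to\psi_\infty$ strongly in $Q$. Here a minimizing sequence for a functional on a set is a sequence of elements of the set along which the functional converges to its infimum over the set. -/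

import Mathlib

open MeasureTheory Filter Topology Set

noncomputable section

namespace DeltaPrime

/-- The complex Hilbert space `L²(ℝ)`, identified with `L²(ℝ⁺) ⊕ L²(ℝ⁻)`. -/
abbrev L2 : Type := Lp ℂ 2 (volume : Measure ℝ)

/-- `v` is the distributional derivative of `u` on the open set `Ω ⊆ ℝ`. -/
def HasWeakDerivOn (Ω : Set ℝ) (u v : L2) : Prop :=
  ∀ φ : ℝ → ℝ, ContDiff ℝ (⊤ : ℕ∞) φ → HasCompactSupport φ → tsupport φ ⊆ Ω →
    ∫ x, deriv φ x • u x = - ∫ x, φ x • v x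

lemma integrable_test_smul {φ : ℝ → ℝ} (hφ : Continuous φ) (hc : HasCompactSupport φ) (u : L2) :
    Integrable (fun x => φ x • u x) :=
  ((Lp.memLp u).locallyIntegrable (by norm_num)).integrable_smul_left_of_hasCompactSupport hφ hc

lemma hasWeakDerivOn_zero (Ω : Set ℝ) : HasWeakDerivOn Ω 0 0 := by
  intro φ _ _ _
  have h0 : ∀ g : ℝ → ℝ, ∫ x, g x • (0 : L2) x = 0 := by
    intro g
    refine integral_eq_zero_of_ae ?_
    filter_upwards [Lp.coeFn_zero ℂ 2 (volume : Measure ℝ)] with x hx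
    rw [hx]
    simp
  rw [h0, h0, neg_zero]

lemma HasWeakDerivOn.add {Ω : Set ℝ} {u v u' v' : L2} (h : HasWeakDerivOn Ω u v)
    (h' : HasWeakDerivOn Ω u' v') : HasWeakDerivOn Ω (u + u') (v + v') := by
  intro φ hφ hc hs
  have key : ∀ (g : ℝ → ℝ), Continuous g → HasCompactSupport g → ∀ a b : L2,
      ∫ x, g x • (a + b : L2) x = (∫ x, g x • a x) + ∫ x, g x • b x := by
    intro g hg hgc a b
    rw [← integral_add (integrable_test_smul hg hgc a) (integrable_test_smul hg hgc b)]
    refine integral_congr_ae ?_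
    filter_upwards [Lp.coeFn_add a b] with x hx
    rw [hx, Pi.add_apply, smul_add]
  rw [key _ (hφ.continuous_deriv (by simp)) hc.deriv, key _ hφ.continuous hc,
    h φ hφ hc hs, h' φ hφ hc hs]
  ring

lemma HasWeakDerivOn.smul {Ω : Set ℝ} {u v : L2} (c : ℂ) (h : HasWeakDerivOn Ω u v) :
    HasWeakDerivOn Ω (c • u) (c • v) := by
  intro φ hφ hc hs
  have key : ∀ (g : ℝ → ℝ) (a : L2), ∫ x, g x • (c • a : L2) x = c • ∫ x, g x • a x := by
    intro g a
    rw [← integral_smul]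
    refine integral_congr_ae ?_
    filter_upwards [Lp.coeFn_smul c a] with x hx
    rw [hx, Pi.smul_apply, smul_comm]
  rw [key, key, h φ hφ hc hs, smul_neg]

/-- The energy space `H¹(ℝ⁺) ⊕ H¹(ℝ⁻)`. An element is stored as the pair `(ψ, ψ')` of a function
`ψ ∈ L²(ℝ)` and its piecewise derivative `ψ' ∈ L²(ℝ)` (the weak derivative on each open half-line,
which `ψ` determines; a jump at the origin is allowed). The Hilbert structure inherited from
`L² × L²` is `(φ, ψ)_Q = (φ, ψ) + (φ', ψ')`, so that `‖ψ‖_Q² = ‖ψ‖² + ‖ψ'‖²`. -/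
def energySpace : Submodule ℂ (WithLp 2 (L2 × L2)) where
  carrier := {p | HasWeakDerivOn (Ioi 0) p.fst p.snd ∧ HasWeakDerivOn (Iio 0) p.fst p.snd}
  zero_mem' := ⟨hasWeakDerivOn_zero _, hasWeakDerivOn_zero _⟩
  add_mem' h h' := ⟨h.1.add h'.1, h.2.add h'.2⟩
  smul_mem' c _ h := ⟨h.1.smul c, h.2.smul c⟩

/-- The energy space as a type, with its inner product. -/
abbrev Q : Type := ↥energySpace

/-- The function `ψ`. -/
def Q.fn (ψ : Q) : L2 := (ψ : WithLp 2 (L2 × L2)).fst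

/-- The piecewise derivative `ψ'`. -/
def Q.dfn (ψ : Q) : L2 := (ψ : WithLp 2 (L2 × L2)).snd

/-- The boundary value `ψ(0+)`: the essential limit of `ψ(x)` as `x → 0`, `x > 0`
(that is, the limit at `0` of the continuous representative of `ψ` on `(0, ∞)`). -/
def Q.rightValue (ψ : Q) : ℂ := limUnder (𝓝[>] (0 : ℝ) ⊓ ae volume) ψ.fn

/-- The boundary value `ψ(0-)`. -/
def Q.leftValue (ψ : Q) : ℂ := limUnder (𝓝[<] (0 : ℝ) ⊓ ae volume) ψ.fn

/-- The quadratic form `F_γ(ψ) = ‖ψ'‖² - γ⁻¹ |ψ(0+) - ψ(0-)|²` of the `δ'` interaction. -/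
def quadForm (γ : ℝ) (ψ : Q) : ℝ :=
  ‖ψ.dfn‖ ^ 2 - γ⁻¹ * ‖ψ.rightValue - ψ.leftValue‖ ^ 2

/-- The mass `M(ψ) = ‖ψ‖²`. -/
def mass (ψ : Q) : ℝ := ‖ψ.fn‖ ^ 2

/-- `‖ψ‖_p^p` with `p = 2μ + 2`. -/
def powerNorm (μ : ℝ) (ψ : Q) : ℝ := ∫ x, ‖ψ.fn x‖ ^ (2 * μ + 2)

/-- The energy `E`. -/
def energy (γ lam μ : ℝ) (ψ : Q) : ℝ :=
  1 / 2 * quadForm γ ψ - lam / (2 * μ + 2) * powerNorm μ ψ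

/-- The action `S_ω = E + (ω / 2) M`. -/
def action (γ lam μ ω : ℝ) (ψ : Q) : ℝ := energy γ lam μ ψ + ω / 2 * mass ψ

/-- The Nehari functional `I_ω`. -/
def nehari (γ lam μ ω : ℝ) (ψ : Q) : ℝ :=
  quadForm γ ψ + ω * mass ψ - lam * powerNorm μ ψ

/-- The reduced action `S̃`. -/
def reducedAction (lam μ : ℝ) (ψ : Q) : ℝ := lam * μ / (2 * (μ + 1)) * powerNorm μ ψ

/-- The Nehari manifold: nonzero `ψ ∈ Q` with `I_ω(ψ) = 0`. -/
def nehariManifold (γ lam μ ω : ℝ) : Set Q := {ψ | ψ ≠ 0 ∧ nehari γ lam μ ω ψ = 0}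

/-- The nonzero `ψ ∈ Q` with `I_ω(ψ) ≤ 0`. -/
def nehariRegion (γ lam μ ω : ℝ) : Set Q := {ψ | ψ ≠ 0 ∧ nehari γ lam μ ω ψ ≤ 0}

/-- `d(ω)`, the infimum of the action on the Nehari manifold. -/
def d (γ lam μ ω : ℝ) : ℝ := sInf (action γ lam μ ω '' nehariManifold γ lam μ ω)

/-- `u` is a minimizing sequence for the functional `J` on the set `A`: its members lie in `A`
and `J (u n)` converges to the (finite) infimum of `J` on `A`. -/
def IsMinimizingSeq (J : Q → ℝ) (A : Set Q) (u : ℕ → Q) : Prop :=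
  (∀ n, u n ∈ A) ∧ ∃ m, IsGLB (J '' A) m ∧ Tendsto (fun n => J (u n)) atTop (𝓝 m)

/-- Weak convergence in `Q`, tested against all bounded linear functionals. -/
def WeaklyTendsto (u : ℕ → Q) (ψ : Q) : Prop :=
  ∀ ℓ : Q →L[ℂ] ℂ, Tendsto (fun n => ℓ (u n)) atTop (𝓝 (ℓ ψ))

end DeltaPrime

end

/-!
For `ω > 4 / γ²` the trace inequality `|ψ(0±)|² ≤ a⁻¹ ‖ψ'‖² + a ‖ψ‖²` on each half-line makes
the quadratic part of `I_ω` coercive on `Q`. On the Nehari manifold `S_ω = S̃`, and `S̃` is a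
multiple of the power norm `‖ψ‖_{2μ+2}^{2μ+2}`; since `I_ω(ψ) < 0` allows `ψ` to be scaled down
onto the manifold, everything reduces to minimizing the power norm over the region `I_ω ≤ 0`.

A minimizing sequence cannot vanish weakly. If it did, its boundary values would tend to zero and
could be removed, leaving `H¹(ℝ)` functions which, having power norm bounded below, are large at
some point. Cutting such a function at that point and moving the cut to the origin creates a jump
that lowers `I_ω` by a definite amount, so one of the two halves can be scaled down to a power norm
below the infimum. For a nonzero weak limit, the Brezis–Lieb lemma splits the power norm and `I_ω`
into the contributions of the limit and of the remainder, which puts the limit in the region with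
the whole minimal power norm; coercivity then makes the remainder tend to zero in norm.
-/

noncomputable section

namespace DeltaPrime

/-! ### Weak derivatives on an interval -/

section WeakDerivative

variable {E : Type*} [NormedAddCommGroup E] [NormedSpace ℝ E]

lemma exists_test_deriv_eq {Ω : Set ℝ} (hΩ : Ω.OrdConnected) {θ : ℝ → ℝ}
    (hθ : ContDiff ℝ (⊤ : ℕ∞) θ) (hc : HasCompactSupport θ) (hs : tsupport θ ⊆ Ω)
    (h0 : ∫ x, θ x = 0) :
    ∃ Θ : ℝ → ℝ, ContDiff ℝ (⊤ : ℕ∞) Θ ∧ HasCompactSupport Θ ∧ tsupport Θ ⊆ Ω ∧ deriv Θ = θ := by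
  rcases (tsupport θ).eq_empty_or_nonempty with hempty | hne
  · rw [tsupport_eq_empty_iff] at hempty
    subst hempty
    exact ⟨0, contDiff_const, HasCompactSupport.zero, by simp, deriv_zero⟩
  obtain ⟨a, ha, hmin⟩ := hc.isCompact.exists_isLeast hne
  obtain ⟨b, hb, hmax⟩ := hc.isCompact.exists_isGreatest hne
  have hmem : ∀ x, θ x ≠ 0 → a ≤ x ∧ x ≤ b := fun x hx =>
    ⟨hmin (subset_tsupport θ hx), hmax (subset_tsupport θ hx)⟩
  set Θ : ℝ → ℝ := fun y => ∫ t in (a - 1)..y, θ t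
  have hbelow : ∀ x < a, Θ x = 0 := fun x hx => by
    refine intervalIntegral.integral_zero_ae (ae_of_all _ fun t ht => ?_)
    by_contra hne
    rcases le_max_iff.1 ht.2 with h | h <;> linarith [(hmem t hne).1]
  have habove : ∀ x, b < x → Θ x = 0 := fun x hx => by
    rw [← h0]
    refine intervalIntegral.integral_eq_integral_of_support_subset fun t ht => ?_
    exact ⟨by linarith [(hmem t ht).1], (hmem t ht).2.trans hx.le⟩
  have hsub : tsupport Θ ⊆ Icc a b := closure_minimal
    (fun x hx => ⟨not_lt.1 (mt (hbelow x) hx), not_lt.1 (mt (habove x) hx)⟩) isClosed_Icc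
  have hderiv : ∀ x, HasDerivAt Θ (θ x) x := fun x =>
    (hθ.continuous.integral_hasStrictDerivAt (a - 1) x).hasDerivAt
  have hΘ' : deriv Θ = θ := funext fun x => (hderiv x).deriv
  exact ⟨Θ, contDiff_infty_iff_deriv.2 ⟨fun x => (hderiv x).differentiableAt, hΘ' ▸ hθ⟩,
    isCompact_Icc.of_isClosed_subset (isClosed_tsupport Θ) hsub,
    hsub.trans (hΩ.out (hs ha) (hs hb)), hΘ'⟩

lemma integrable_smul_of_tsupport_subset {Ω : Set ℝ} {f : ℝ → E} (hf : LocallyIntegrableOn f Ω)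
    {φ : ℝ → ℝ} (hφ : Continuous φ) (hc : HasCompactSupport φ) (hs : tsupport φ ⊆ Ω) :
    Integrable fun x => φ x • f x := by
  have h : IntegrableOn (fun x => φ x • f x) (tsupport φ) :=
    (hf.integrableOn_compact_subset hs hc).continuousOn_smul hφ.continuousOn hc
  exact (integrableOn_iff_integrable_of_support_subset
    ((Function.support_smul_subset_left φ f).trans (subset_tsupport φ))).1 h

lemma exists_test_integral_eq_one {Ω : Set ℝ} (hΩ : IsOpen Ω) (hne : Ω.Nonempty) :
    ∃ η : ℝ → ℝ, ContDiff ℝ (⊤ : ℕ∞) η ∧ HasCompactSupport η ∧ tsupport η ⊆ Ω ∧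
      ∫ x, η x = 1 := by
  obtain ⟨c, hc⟩ := hne
  obtain ⟨r, hr, hsub⟩ := Metric.nhds_basis_closedBall.mem_iff.1 (hΩ.mem_nhds hc)
  let χ : ContDiffBump c := ⟨r / 2, r, half_pos hr, half_lt_self hr⟩
  exact ⟨χ.normed volume, χ.contDiff_normed, χ.hasCompactSupport_normed,
    χ.tsupport_normed_eq.trans_subset hsub, χ.integral_normed⟩

/-- The lemma of du Bois-Reymond. -/
lemma exists_ae_eq_const_of_integral_deriv_smul_eq_zero [CompleteSpace E] {Ω : Set ℝ}
    (hΩ : IsOpen Ω) (hΩ' : Ω.OrdConnected) {f : ℝ → E} (hf : LocallyIntegrableOn f Ω)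
    (h : ∀ φ : ℝ → ℝ, ContDiff ℝ (⊤ : ℕ∞) φ → HasCompactSupport φ → tsupport φ ⊆ Ω →
      ∫ x, deriv φ x • f x = 0) :
    ∃ c, ∀ᵐ x, x ∈ Ω → f x = c := by
  rcases Ω.eq_empty_or_nonempty with rfl | hne
  · exact ⟨0, by simp⟩
  obtain ⟨η, hη, hηc, hηs, hη1⟩ := exists_test_integral_eq_one hΩ hne
  set c : E := ∫ x, η x • f x
  refine ⟨c, ?_⟩
  suffices h0 : ∀ᵐ x, x ∈ Ω → f x - c = 0 by simpa only [sub_eq_zero] using h0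
  refine hΩ.ae_eq_zero_of_integral_contDiff_smul_eq_zero
    (hf.sub ((locallyIntegrable_const c).locallyIntegrableOn Ω)) fun φ hφ hφc hφs => ?_
  have hφi : Integrable φ := hφ.continuous.integrable_of_hasCompactSupport hφc
  have hηi : Integrable η := hη.continuous.integrable_of_hasCompactSupport hηc
  set m : ℝ := ∫ x, φ x
  obtain ⟨Θ, hΘ, hΘc, hΘs, hΘ'⟩ := exists_test_deriv_eq hΩ' (θ := fun x => φ x - m • η x)
    (hφ.sub (hη.const_smul m)) (hφc.sub (hηc.smul_left (f := fun _ => m)))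
    ((tsupport_sub φ fun x => m • η x).trans
      (union_subset hφs ((tsupport_smul_subset_right (fun _ => m) η).trans hηs)))
    (by rw [integral_sub hφi (hηi.fun_smul m), integral_smul, hη1, smul_eq_mul, mul_one, sub_self])
  have hφf := integrable_smul_of_tsupport_subset hf hφ.continuous hφc hφs
  have hηf := integrable_smul_of_tsupport_subset hf hη.continuous hηc hηs
  have key : ∫ x, φ x • f x = m • c := by
    have := h Θ hΘ hΘc hΘs
    simp_rw [hΘ', sub_smul, smul_assoc] at this
    rwa [integral_sub hφf (hηf.fun_smul m), integral_smul, sub_eq_zero] at this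
  simp_rw [smul_sub]
  rw [integral_sub hφf (hφi.smul_const c), key, integral_smul_const, sub_self]

lemma integral_Ioi_deriv_smul_integral_Ioi [CompleteSpace E] {b : ℝ} {χ : ℝ → ℝ}
    (hχ : ContDiff ℝ 1 χ) (hc : HasCompactSupport χ) {h : ℝ → E} (hh : IntegrableOn h (Ioi b)) :
    ∫ x in Ioi b, deriv χ x • ∫ s in Ioi x, h s =
      (∫ s in Ioi b, χ s • h s) - χ b • ∫ s in Ioi b, h s := by
  have hχ' : Continuous (deriv χ) := hχ.continuous_deriv le_rfl
  have hχh : IntegrableOn (fun s => χ s • h s) (Ioi b) := by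
    obtain ⟨C, hC⟩ := hc.exists_bound_of_continuous hχ.continuous
    exact hh.bdd_smul C hχ.continuous.aestronglyMeasurable (ae_of_all _ hC)
  set T : Set (ℝ × ℝ) := {z | z.1 < z.2}
  set K : ℝ → ℝ → E := fun x s => T.indicator (fun z => deriv χ z.1 • h z.2) (x, s)
  have hKint : Integrable (Function.uncurry K)
      ((volume.restrict (Ioi b)).prod (volume.restrict (Ioi b))) :=
    (Integrable.smul_prod (hχ'.integrable_of_hasCompactSupport hc.deriv).integrableOn
      hh).indicator (measurableSet_lt measurable_fst measurable_snd)
  have hinner : ∀ x ∈ Ioi b, deriv χ x • ∫ s in Ioi x, h s = ∫ s in Ioi b, K x s := by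
    intro x hx
    have e : K x = (Ioi x).indicator fun s => deriv χ x • h s := rfl
    rw [e, setIntegral_indicator measurableSet_Ioi, Ioi_inter_Ioi, sup_eq_right.2 (le_of_lt hx),
      integral_smul]
  have houter : ∀ s ∈ Ioi b, ∫ x in Ioi b, K x s = χ s • h s - χ b • h s := by
    intro s hs
    have e : (fun x => K x s) = (Iio s).indicator fun x => deriv χ x • h s := rfl
    rw [e, setIntegral_indicator measurableSet_Iio, Ioi_inter_Iio, integral_smul_const,
      ← integral_Ioc_eq_integral_Ioo, ← intervalIntegral.integral_of_le (le_of_lt hs),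
      intervalIntegral.integral_deriv_eq_sub
        (fun x _ => hχ.differentiable one_ne_zero x) (hχ'.intervalIntegrable _ _), sub_smul]
  rw [setIntegral_congr_fun measurableSet_Ioi hinner, integral_integral_swap hKint,
    setIntegral_congr_fun measurableSet_Ioi houter, integral_sub hχh (hh.fun_smul (χ b)),
    integral_smul]

lemma setIntegral_smul_eq_integral {S : Set ℝ} {φ : ℝ → ℝ} (hs : tsupport φ ⊆ S) (f : ℝ → E) :
    ∫ x in S, φ x • f x = ∫ x, φ x • f x :=
  setIntegral_eq_integral_of_forall_compl_eq_zero fun x hx => by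
    rw [image_eq_zero_of_notMem_tsupport fun h => hx (hs h), zero_smul]

lemma exists_ae_eq_const_add_integral_Ioi [CompleteSpace E] {b : ℝ} {f h : ℝ → E}
    (hf : LocallyIntegrableOn f (Ioi b)) (hh : IntegrableOn h (Ioi b))
    (hw : ∀ φ : ℝ → ℝ, ContDiff ℝ (⊤ : ℕ∞) φ → HasCompactSupport φ → tsupport φ ⊆ Ioi b →
      ∫ x, deriv φ x • f x = ∫ x, φ x • h x) :
    ∃ c, ∀ᵐ x, x ∈ Ioi b → f x = c + ∫ s in Ioi x, h s := by
  have hprim : LocallyIntegrableOn (fun x => ∫ s in Ioi x, h s) (Ioi b) :=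
    (hh.continuousOn_Ici_primitive_Ioi.mono Ioi_subset_Ici_self).locallyIntegrableOn
      measurableSet_Ioi
  obtain ⟨c, hc⟩ := exists_ae_eq_const_of_integral_deriv_smul_eq_zero isOpen_Ioi ordConnected_Ioi
    (hf.sub hprim) fun φ hφ hφc hφs => by
      have hφs' : tsupport (deriv φ) ⊆ Ioi b := tsupport_deriv_subset.trans hφs
      have hcont := hφ.continuous_deriv (by simp)
      have hprim' : ∫ x, deriv φ x • ∫ s in Ioi x, h s = ∫ x, φ x • h x := by
        rw [← setIntegral_smul_eq_integral hφs',
          integral_Ioi_deriv_smul_integral_Ioi (hφ.of_le (by simp)) hφc hh,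
          image_eq_zero_of_notMem_tsupport fun hb => lt_irrefl b (hφs hb), zero_smul, sub_zero,
          setIntegral_smul_eq_integral hφs]
      simp_rw [Pi.sub_apply, smul_sub]
      rw [integral_sub (integrable_smul_of_tsupport_subset hf hcont hφc.deriv hφs')
        (integrable_smul_of_tsupport_subset hprim hcont hφc.deriv hφs'), hw φ hφ hφc hφs, hprim',
        sub_self]
  refine ⟨c, hc.mono fun x hx hxb => ?_⟩
  rw [← hx hxb, Pi.sub_apply, sub_add_cancel]

end WeakDerivative

/-! ### The exponential kernel -/

lemma Lp_two_norm_sq {α F : Type*} [MeasurableSpace α] {μ : Measure α} [NormedAddCommGroup F]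
    (f : Lp F 2 μ) : ‖f‖ ^ 2 = ∫ x, ‖f x‖ ^ 2 ∂μ := by
  have hnn : 0 ≤ ∫ x, ‖f x‖ ^ 2 ∂μ := integral_nonneg fun x => by positivity
  rw [Lp.norm_def, (Lp.memLp f).eLpNorm_eq_integral_rpow_norm two_ne_zero ENNReal.ofNat_ne_top,
    ENNReal.toReal_ofReal (by positivity)]
  simp only [ENNReal.toReal_ofNat, Real.rpow_two]
  rw [← Real.rpow_natCast, ← Real.rpow_mul hnn]
  norm_num

lemma memLp_exp_neg_mul_Ioi {a : ℝ} (ha : 0 < a) (x : ℝ) :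
    MemLp (fun s => Real.exp (-(a * s))) 2 (volume.restrict (Ioi x)) := by
  have hcont : Continuous fun s => Real.exp (-(a * s)) := by fun_prop
  rw [memLp_two_iff_integrable_sq hcont.aestronglyMeasurable]
  refine (integrableOn_exp_mul_Ioi (a := -(2 * a)) (by linarith) x).congr_fun (fun s _ => ?_)
    measurableSet_Ioi
  simp only [← Real.exp_nat_mul]
  congr 1
  push_cast
  ring

/-- The function `s ↦ e^{a (x - s)}` on `(x, ∞)`, extended by zero, as an element of `L²`. Its
inner product with `a u - u'` is the value at `x` of the continuous representative of `u`. -/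
def expKernel {a : ℝ} (ha : 0 < a) (x : ℝ) : L2 :=
  MemLp.toLp ((Ioi x).indicator fun s => ((Real.exp (a * x) * Real.exp (-(a * s)) : ℝ) : ℂ))
    ((memLp_indicator_iff_restrict measurableSet_Ioi).2
      ((memLp_exp_neg_mul_Ioi ha x).const_mul (Real.exp (a * x))).ofReal)

lemma coeFn_expKernel {a : ℝ} (ha : 0 < a) (x : ℝ) :
    expKernel ha x =ᵐ[volume]
      (Ioi x).indicator fun s => ((Real.exp (a * x) * Real.exp (-(a * s)) : ℝ) : ℂ) :=
  MemLp.coeFn_toLp _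

lemma norm_expKernel_sq {a : ℝ} (ha : 0 < a) (x : ℝ) : ‖expKernel ha x‖ ^ 2 = 1 / (2 * a) := by
  have hsq : (fun s => ‖expKernel ha x s‖ ^ 2) =ᵐ[volume]
      (Ioi x).indicator fun s => Real.exp (2 * a * x) * Real.exp (-(2 * a) * s) := by
    filter_upwards [coeFn_expKernel ha x] with s hs
    rw [hs]
    by_cases h : s ∈ Ioi x
    · rw [indicator_of_mem h, indicator_of_mem h, Complex.norm_real, Real.norm_eq_abs, sq_abs,
        mul_pow, ← Real.exp_nat_mul, ← Real.exp_nat_mul]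
      push_cast
      ring_nf
    · simp [indicator_of_notMem h]
  rw [Lp_two_norm_sq, integral_congr_ae hsq, integral_indicator measurableSet_Ioi,
    integral_const_mul, integral_exp_mul_Ioi (by linarith), neg_div_neg_eq, ← mul_div_assoc,
    ← Real.exp_add, neg_mul, add_neg_cancel, Real.exp_zero]

lemma integrableOn_exp_smul {a : ℝ} (ha : 0 < a) (g : L2) (x : ℝ) :
    IntegrableOn (fun s => Real.exp (-(a * s)) • g s) (Ioi x) :=
  memLp_one_iff_integrable.1 (((Lp.memLp g).restrict (Ioi x)).smul (memLp_exp_neg_mul_Ioi ha x))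

lemma inner_expKernel {a : ℝ} (ha : 0 < a) (x : ℝ) (g : L2) :
    inner ℂ (expKernel ha x) g = Real.exp (a * x) • ∫ s in Ioi x, Real.exp (-(a * s)) • g s := by
  rw [L2.inner_def, ← integral_smul, ← integral_indicator measurableSet_Ioi]
  refine integral_congr_ae ?_
  filter_upwards [coeFn_expKernel ha x] with s hs
  rw [hs]
  by_cases h : s ∈ Ioi x
  · rw [indicator_of_mem h, indicator_of_mem h, RCLike.inner_apply, Complex.conj_ofReal, smul_smul,
      Complex.real_smul, mul_comm]
  · simp [indicator_of_notMem h]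

lemma continuous_inner_expKernel {a : ℝ} (ha : 0 < a) (g : L2) :
    Continuous fun x => inner ℂ (expKernel ha x) g := by
  have htail : Continuous fun x => ∫ s in Ioi x, Real.exp (-(a * s)) • g s :=
    continuous_iff_continuousAt.2 fun x =>
      (integrableOn_exp_smul ha g (x - 1)).continuousOn_Ici_primitive_Ioi.continuousAt
        (Ici_mem_nhds (sub_one_lt x))
  have hexp : Continuous fun x => Real.exp (a * x) := by fun_prop
  exact (hexp.smul htail).congr fun x => (inner_expKernel ha x g).symm

lemma eq_zero_of_exp_le_norm_add {u : L2} {a b K : ℝ} (ha : 0 < a) {c : ℂ}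
    (h : ∀ᵐ x : ℝ, x ∈ Ioi b → ‖c‖ * Real.exp (a * x) ≤ ‖u x‖ + K) : c = 0 := by
  by_contra hc
  have hlim : Tendsto (fun x => ‖c‖ * Real.exp (a * x)) atTop atTop :=
    (Real.tendsto_exp_atTop.comp (tendsto_id.const_mul_atTop ha)).const_mul_atTop
      (norm_pos_iff.2 hc)
  obtain ⟨R, hR⟩ := eventually_atTop.1 (hlim.eventually_ge_atTop (1 + K))
  have hfin := (Lp.memLp u).meas_ge_lt_top two_ne_zero ENNReal.ofNat_ne_top one_ne_zero
  refine hfin.ne (top_unique ?_)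
  rw [← Real.volume_Ioi (a := max b R)]
  refine measure_mono_ae ?_
  filter_upwards [h] with x hx hxR
  have h1 := hx ((le_max_left b R).trans_lt hxR)
  have h2 := hR x ((le_max_right b R).trans hxR.le)
  have h3 : (1 : ℝ) ≤ ‖u x‖ := by linarith
  exact h3

lemma coeFn_ofReal_smul_sub (a : ℝ) (u v : L2) :
    ((a : ℂ) • u - v : L2) =ᵐ[volume] fun x => a • u x - v x := by
  filter_upwards [Lp.coeFn_sub ((a : ℂ) • u) v, Lp.coeFn_smul (a : ℂ) u] with x h₁ h₂
  rw [h₁, Pi.sub_apply, h₂, Pi.smul_apply, Complex.coe_smul]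

namespace HasWeakDerivOn

lemma integral_deriv_smul_smul {Ω : Set ℝ} {u v : L2} (h : HasWeakDerivOn Ω u v) {m φ : ℝ → ℝ}
    (hm : ContDiff ℝ (⊤ : ℕ∞) m) (hφ : ContDiff ℝ (⊤ : ℕ∞) φ) (hc : HasCompactSupport φ)
    (hs : tsupport φ ⊆ Ω) :
    ∫ x, deriv φ x • m x • u x = - ∫ x, φ x • (deriv m x • u x + m x • v x) := by
  have hφ' := hφ.continuous_deriv (by simp)
  have hm' := hm.continuous_deriv (by simp)
  have key := h (fun x => φ x * m x) (hφ.mul hm) hc.mul_right ((tsupport_mul_subset_left).trans hs)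
  have hderiv : ∀ x, deriv (fun x => φ x * m x) x = deriv φ x * m x + φ x * deriv m x := fun x =>
    deriv_fun_mul (hφ.differentiable (by simp) x) (hm.differentiable (by simp) x)
  have hi₁ : Integrable fun x => (deriv φ x * m x) • u x :=
    integrable_test_smul (hφ'.mul hm.continuous) hc.deriv.mul_right u
  have hi₂ : Integrable fun x => (φ x * deriv m x) • u x :=
    integrable_test_smul (hφ.continuous.mul hm') hc.mul_right u
  have hi₃ : Integrable fun x => (φ x * m x) • v x :=
    integrable_test_smul (hφ.continuous.mul hm.continuous) hc.mul_right v
  simp_rw [hderiv, add_smul] at key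
  rw [integral_add hi₁ hi₂] at key
  simp_rw [smul_add, smul_smul]
  rw [integral_add hi₂ hi₃]
  linear_combination key

lemma ae_eq_inner_expKernel {b : ℝ} {u v : L2} (h : HasWeakDerivOn (Ioi b) u v) {a : ℝ}
    (ha : 0 < a) :
    ∀ᵐ x : ℝ, x ∈ Ioi b → u x = inner ℂ (expKernel ha x) ((a : ℂ) • u - v) := by
  set g : L2 := (a : ℂ) • u - v
  have hms : ContDiff ℝ (⊤ : ℕ∞) fun x => Real.exp (-(a * x)) := by fun_prop
  have hm' : ∀ x, deriv (fun x => Real.exp (-(a * x))) x = -a * Real.exp (-(a * x)) := fun x => by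
    have := (((hasDerivAt_id' x).const_mul a).fun_neg).exp
    rw [this.deriv]
    ring
  have hexp : ∀ x, Real.exp (a * x) * Real.exp (-(a * x)) = 1 := fun x => by
    rw [← Real.exp_add, add_neg_cancel, Real.exp_zero]
  obtain ⟨c, hc⟩ := exists_ae_eq_const_add_integral_Ioi
    (f := fun x => Real.exp (-(a * x)) • u x) (h := fun s => Real.exp (-(a * s)) • g s)
    (((Lp.memLp u).locallyIntegrable one_le_two |>.locallyIntegrableOn _).continuousOn_smul
      isLocallyClosed_Ioi hms.continuous.continuousOn)
    (integrableOn_exp_smul ha g b) fun φ hφ hφc hφs => by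
      rw [h.integral_deriv_smul_smul hms hφ hφc hφs, ← integral_neg]
      refine integral_congr_ae ?_
      filter_upwards [coeFn_ofReal_smul_sub a u v] with x hx
      rw [hx, hm', ← smul_neg, smul_sub, neg_add, neg_mul, neg_smul, neg_neg, smul_smul,
        mul_comm a, sub_eq_add_neg]
  have hu : ∀ᵐ x : ℝ, x ∈ Ioi b → u x = Real.exp (a * x) • c + inner ℂ (expKernel ha x) g := by
    filter_upwards [hc] with x hx hxb
    rw [inner_expKernel, ← smul_add, ← hx hxb, smul_smul, hexp, one_smul]
  have hc0 : c = 0 := eq_zero_of_exp_le_norm_add (K := √(1 / (2 * a)) * ‖g‖) ha <| by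
    filter_upwards [hu] with x hx hxb
    have hnorm : ‖expKernel ha x‖ = √(1 / (2 * a)) := by
      rw [← norm_expKernel_sq ha x, Real.sqrt_sq (norm_nonneg _)]
    calc ‖c‖ * Real.exp (a * x) = ‖u x - inner ℂ (expKernel ha x) g‖ := by
          rw [hx hxb, add_sub_cancel_right, norm_smul, Real.norm_eq_abs, Real.abs_exp, mul_comm]
      _ ≤ ‖u x‖ + ‖expKernel ha x‖ * ‖g‖ :=
          (norm_sub_le _ _).trans (add_le_add_right (norm_inner_le_norm _ _) _)
      _ = ‖u x‖ + √(1 / (2 * a)) * ‖g‖ := by rw [hnorm]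
  filter_upwards [hu] with x hx hxb
  rw [hx hxb, hc0, smul_zero, zero_add]

lemma setIntegral_Ioi_deriv_smul {b : ℝ} {u v : L2} (h : HasWeakDerivOn (Ioi b) u v) {a : ℝ}
    (ha : 0 < a) {φ : ℝ → ℝ} (hφ : ContDiff ℝ 1 φ) (hc : HasCompactSupport φ) :
    ∫ x in Ioi b, deriv φ x • u x =
      -(∫ x in Ioi b, φ x • v x) - φ b • inner ℂ (expKernel ha b) ((a : ℂ) • u - v) := by
  set g : L2 := (a : ℂ) • u - v
  have hcancel : ∀ x, Real.exp (a * x) * Real.exp (-(a * x)) = 1 := fun x => by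
    rw [← Real.exp_add, add_neg_cancel, Real.exp_zero]
  have hexp : ContDiff ℝ 1 fun x => Real.exp (a * x) := by fun_prop
  have hχ' : ∀ x, deriv (fun x => φ x * Real.exp (a * x)) x =
      (deriv φ x + a * φ x) * Real.exp (a * x) := fun x => by
    have := (hφ.differentiable one_ne_zero x).hasDerivAt.fun_mul
      (((hasDerivAt_id' x).const_mul a).exp)
    rw [this.deriv]
    ring
  have hint : ∀ (w : L2) {ψ : ℝ → ℝ}, Continuous ψ → HasCompactSupport ψ →
      IntegrableOn (fun x => ψ x • w x) (Ioi b) := fun w ψ hψ hψc =>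
    (integrable_test_smul hψ hψc w).integrableOn
  have key := integral_Ioi_deriv_smul_integral_Ioi (hφ.mul hexp) hc.mul_right
    (integrableOn_exp_smul ha g b)
  have hleft : ∫ x in Ioi b, deriv (fun x => φ x * Real.exp (a * x)) x •
      ∫ s in Ioi x, Real.exp (-(a * s)) • g s =
      (∫ x in Ioi b, deriv φ x • u x) + a • ∫ x in Ioi b, φ x • u x := by
    rw [← integral_smul, ← integral_add
      (hint u (hφ.continuous_deriv le_rfl) hc.deriv) ((hint u hφ.continuous hc).fun_smul a)]
    refine setIntegral_congr_ae measurableSet_Ioi ?_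
    filter_upwards [h.ae_eq_inner_expKernel ha] with x hx hxb
    rw [hχ', mul_smul, ← inner_expKernel ha x g, ← hx hxb, add_smul, mul_smul]
  have hright : ∫ s in Ioi b, (φ s * Real.exp (a * s)) • Real.exp (-(a * s)) • g s =
      a • (∫ x in Ioi b, φ x • u x) - ∫ x in Ioi b, φ x • v x := by
    rw [← integral_smul, ← integral_sub ((hint u hφ.continuous hc).fun_smul a)
      (hint v hφ.continuous hc)]
    refine integral_congr_ae (ae_restrict_of_ae ?_)
    filter_upwards [coeFn_ofReal_smul_sub a u v] with x hx
    rw [hx, smul_smul, mul_assoc, hcancel, mul_one, smul_sub, smul_comm]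
  rw [hleft, hright, mul_smul, ← inner_expKernel ha b g] at key
  linear_combination key

end HasWeakDerivOn

/-! ### Reflections, translations and restrictions -/

/-- The reflection `u ↦ u(-·)` on `L²`. -/
def reflL2 : L2 →ₗᵢ[ℂ] L2 :=
  Lp.compMeasurePreservingₗᵢ ℂ (Neg.neg : ℝ → ℝ) (Measure.measurePreserving_neg volume)

lemma coeFn_reflL2 (u : L2) : reflL2 u =ᵐ[volume] fun x => u (-x) :=
  Lp.coeFn_compMeasurePreserving u (Measure.measurePreserving_neg volume)

lemma ae_neg {p : ℝ → Prop} (h : ∀ᵐ x, p x) : ∀ᵐ x, p (-x) :=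
  (Measure.measurePreserving_neg (volume : Measure ℝ)).quasiMeasurePreserving.ae h

lemma reflL2_reflL2 (u : L2) : reflL2 (reflL2 u) = u := by
  apply Lp.ext
  filter_upwards [coeFn_reflL2 (reflL2 u), ae_neg (coeFn_reflL2 u)] with x h₁ h₂
  rw [h₁, h₂, neg_neg]

lemma integral_smul_reflL2 (φ : ℝ → ℝ) (u : L2) :
    ∫ x, φ x • reflL2 u x = ∫ x, φ (-x) • u x := by
  rw [← integral_neg_eq_self fun x => φ (-x) • u x]
  refine integral_congr_ae ?_
  filter_upwards [coeFn_reflL2 u] with x hx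
  rw [hx, neg_neg]

/-- The translation `u ↦ u(· + t)` on `L²`. -/
def translL2 (t : ℝ) : L2 →ₗᵢ[ℂ] L2 :=
  Lp.compMeasurePreservingₗᵢ ℂ (fun x : ℝ => x + t) (measurePreserving_add_right volume t)

lemma coeFn_translL2 (t : ℝ) (u : L2) : translL2 t u =ᵐ[volume] fun x => u (x + t) :=
  Lp.coeFn_compMeasurePreserving u (measurePreserving_add_right volume t)

lemma integral_smul_translL2 (t : ℝ) (φ : ℝ → ℝ) (u : L2) :
    ∫ x, φ x • translL2 t u x = ∫ x, φ (x - t) • u x := by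
  rw [← integral_add_right_eq_self (fun x => φ (x - t) • u x) t]
  refine integral_congr_ae ?_
  filter_upwards [coeFn_translL2 t u] with x hx
  rw [hx, add_sub_cancel_right]

/-- Multiplication by the indicator function of `s` on `L²`. -/
def restrL2 {s : Set ℝ} (hs : MeasurableSet s) (u : L2) : L2 := ((Lp.memLp u).indicator hs).toLp _

lemma coeFn_restrL2 {s : Set ℝ} (hs : MeasurableSet s) (u : L2) :
    restrL2 hs u =ᵐ[volume] s.indicator u :=
  ((Lp.memLp u).indicator hs).coeFn_toLp

lemma coeFn_sub_restrL2 {s : Set ℝ} (hs : MeasurableSet s) (u : L2) :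
    (u - restrL2 hs u : L2) =ᵐ[volume] sᶜ.indicator u := by
  filter_upwards [Lp.coeFn_sub u (restrL2 hs u), coeFn_restrL2 hs u] with x h₁ h₂
  rw [h₁, Pi.sub_apply, h₂, indicator_compl, Pi.sub_apply]

lemma integral_comp_norm_restrL2_add {s : Set ℝ} (hs : MeasurableSet s) (u : L2) {F : ℝ → ℝ}
    (hF : F 0 = 0) (hi : Integrable fun x => F ‖u x‖) :
    (∫ x, F ‖restrL2 hs u x‖) + ∫ x, F ‖(u - restrL2 hs u : L2) x‖ = ∫ x, F ‖u x‖ := by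
  have hind : ∀ {t : Set ℝ} {w : L2}, MeasurableSet t → w =ᵐ[volume] t.indicator u →
      ∫ x, F ‖w x‖ = ∫ x in t, F ‖u x‖ := fun {t w} ht hw => by
    rw [← integral_indicator ht]
    refine integral_congr_ae (hw.mono fun x hx => ?_)
    by_cases h : x ∈ t <;> simp [hx, h, hF]
  rw [hind hs (coeFn_restrL2 hs u), hind hs.compl (coeFn_sub_restrL2 hs u),
    integral_add_compl hs hi]

lemma norm_restrL2_sq_add {s : Set ℝ} (hs : MeasurableSet s) (u : L2) :
    ‖restrL2 hs u‖ ^ 2 + ‖u - restrL2 hs u‖ ^ 2 = ‖u‖ ^ 2 := by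
  simp_rw [Lp_two_norm_sq]
  exact integral_comp_norm_restrL2_add hs u (F := fun r => r ^ 2) (by norm_num)
    ((Lp.memLp u).integrable_norm_pow two_ne_zero)

namespace HasWeakDerivOn

lemma mono {Ω Ω' : Set ℝ} {u v : L2} (h : HasWeakDerivOn Ω u v) (hs : Ω' ⊆ Ω) :
    HasWeakDerivOn Ω' u v := fun φ hφ hc ht => h φ hφ hc (ht.trans hs)

lemma congr {Ω : Set ℝ} {u v u' v' : L2} (h : HasWeakDerivOn Ω u v)
    (hu : ∀ᵐ x, x ∈ Ω → u' x = u x) (hv : ∀ᵐ x, x ∈ Ω → v' x = v x) :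
    HasWeakDerivOn Ω u' v' := fun φ hφ hc hs => by
  have key : ∀ {ξ : ℝ → ℝ} {w w' : L2}, tsupport ξ ⊆ Ω → (∀ᵐ x, x ∈ Ω → w' x = w x) →
      ∫ x, ξ x • w' x = ∫ x, ξ x • w x := fun {ξ w w'} hξ hw => by
    refine integral_congr_ae (hw.mono fun x hx => ?_)
    by_cases h0 : x ∈ Ω
    · simp only [hx h0]
    · simp only [image_eq_zero_of_notMem_tsupport fun h => h0 (hξ h), zero_smul]
  rw [key (tsupport_deriv_subset.trans hs) hu, key hs hv, h φ hφ hc hs]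

lemma of_ae_eq_zero {Ω : Set ℝ} {u v : L2} (hu : ∀ᵐ x, x ∈ Ω → u x = 0)
    (hv : ∀ᵐ x, x ∈ Ω → v x = 0) : HasWeakDerivOn Ω u v := by
  refine (hasWeakDerivOn_zero Ω).congr ?_ ?_
  · filter_upwards [hu, Lp.coeFn_zero ℂ 2 (volume : Measure ℝ)] with x h₁ h₂ hx
    rw [h₁ hx, h₂, Pi.zero_apply]
  · filter_upwards [hv, Lp.coeFn_zero ℂ 2 (volume : Measure ℝ)] with x h₁ h₂ hx
    rw [h₁ hx, h₂, Pi.zero_apply]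

lemma refl {Ω Ω' : Set ℝ} {u v : L2} (h : HasWeakDerivOn Ω u v) (hΩ : ∀ x ∈ Ω', -x ∈ Ω) :
    HasWeakDerivOn Ω' (reflL2 u) (-reflL2 v) := fun φ hφ hc hs => by
  have hsupp : tsupport (fun x => φ (-x)) ⊆ Ω := fun x hx => by
    have hx' : -x ∈ tsupport φ := by
      rwa [← mem_preimage, ← Homeomorph.coe_neg, ← tsupport_comp_eq_preimage]
    simpa only [neg_neg] using hΩ _ (hs hx')
  have hderiv : ∀ x, deriv (fun y => φ (-y)) x = -deriv φ (-x) := fun x => deriv_comp_neg _ _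
  have hneg : ∫ x, φ x • (-reflL2 v : L2) x = -∫ x, φ (-x) • v x := by
    rw [← integral_smul_reflL2, ← integral_neg]
    refine integral_congr_ae ?_
    filter_upwards [Lp.coeFn_neg (reflL2 v)] with x hx
    rw [hx, Pi.neg_apply, smul_neg]
  have key := h (fun x => φ (-x)) (hφ.comp contDiff_neg)
    (hc.comp_homeomorph (Homeomorph.neg ℝ)) hsupp
  simp_rw [hderiv, neg_smul, integral_neg] at key
  rw [integral_smul_reflL2, hneg, ← key, neg_neg]

lemma transl {u v : L2} (h : HasWeakDerivOn univ u v) (t : ℝ) :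
    HasWeakDerivOn univ (translL2 t u) (translL2 t v) := fun φ hφ hc _ => by
  rw [integral_smul_translL2, integral_smul_translL2]
  simpa only [deriv_comp_sub_const] using h (fun x => φ (x - t))
    (hφ.comp (contDiff_id.sub contDiff_const)) (hc.comp_homeomorph (Homeomorph.subRight t))
    (subset_univ _)

end HasWeakDerivOn

/-! ### The energy space -/

namespace Q

/-- `ψ ↦ ψ` as a bounded operator `Q → L²`. -/
def fnL : Q →L[ℂ] L2 := (WithLp.fstL 2 ℂ L2 L2) ∘L energySpace.subtypeL

/-- `ψ ↦ ψ'` as a bounded operator `Q → L²`. -/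
def dfnL : Q →L[ℂ] L2 := (WithLp.sndL 2 ℂ L2 L2) ∘L energySpace.subtypeL

lemma hasWeakDerivOn_Ioi (ψ : Q) : HasWeakDerivOn (Ioi 0) ψ.fn ψ.dfn := ψ.2.1

lemma hasWeakDerivOn_Iio (ψ : Q) : HasWeakDerivOn (Iio 0) ψ.fn ψ.dfn := ψ.2.2

lemma norm_sq (ψ : Q) : ‖ψ‖ ^ 2 = ‖ψ.fn‖ ^ 2 + ‖ψ.dfn‖ ^ 2 :=
  WithLp.prod_norm_sq_eq_of_L2 (ψ : WithLp 2 (L2 × L2))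

/-- The element of the energy space with given function and piecewise derivative. -/
def ofWeakDeriv (u v : L2) (hr : HasWeakDerivOn (Ioi 0) u v) (hl : HasWeakDerivOn (Iio 0) u v) :
    Q :=
  ⟨WithLp.toLp 2 (u, v), hr, hl⟩

lemma ext_fn {φ ψ : Q} (h : φ.fn = ψ.fn) (h' : φ.dfn = ψ.dfn) : φ = ψ :=
  Subtype.ext <| (WithLp.equiv 2 (L2 × L2)).injective <| Prod.ext h h'

end Q

/-- The reflection `ψ ↦ ψ(-·)` on the energy space. -/
def reflect : Q →ₗᵢ[ℂ] Q where
  toFun ψ := Q.ofWeakDeriv (reflL2 ψ.fn) (-reflL2 ψ.dfn)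
    (ψ.hasWeakDerivOn_Iio.refl fun _ hx => mem_Iio.2 (neg_neg_iff_pos.2 hx))
    (ψ.hasWeakDerivOn_Ioi.refl fun _ hx => mem_Ioi.2 (neg_pos.2 hx))
  map_add' φ ψ := Q.ext_fn (map_add reflL2 _ _) <|
    (congrArg Neg.neg (map_add reflL2 φ.dfn ψ.dfn)).trans (neg_add _ _)
  map_smul' c ψ := Q.ext_fn (map_smul reflL2 c _) <|
    (congrArg Neg.neg (map_smul reflL2 c ψ.dfn)).trans (smul_neg _ _).symm
  norm_map' ψ := by
    rw [← sq_eq_sq₀ (norm_nonneg _) (norm_nonneg _), Q.norm_sq, Q.norm_sq ψ,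
      ← reflL2.norm_map ψ.fn, ← reflL2.norm_map ψ.dfn, ← norm_neg (reflL2 ψ.dfn)]
    rfl

lemma fn_reflect (ψ : Q) : (reflect ψ).fn = reflL2 ψ.fn := rfl

lemma dfn_reflect (ψ : Q) : (reflect ψ).dfn = -reflL2 ψ.dfn := rfl

lemma reflect_reflect (ψ : Q) : reflect (reflect ψ) = ψ :=
  Q.ext_fn (reflL2_reflL2 _) <| by
    rw [dfn_reflect, dfn_reflect, map_neg, reflL2_reflL2, neg_neg]

/-! ### Point evaluation and boundary values -/

/-- The value at `x ≥ 0` of the continuous representative on the right half-line. The parameter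
`a`, on which this value does not depend, is the one of the exponential kernel; optimizing over it
gives the sharp trace inequality. -/
def rightEval {a : ℝ} (ha : 0 < a) (x : ℝ) : Q →L[ℂ] ℂ :=
  innerSL ℂ (expKernel ha x) ∘L ((a : ℂ) • Q.fnL - Q.dfnL)

lemma rightEval_apply {a : ℝ} (ha : 0 < a) (x : ℝ) (ψ : Q) :
    rightEval ha x ψ = inner ℂ (expKernel ha x) ((a : ℂ) • ψ.fn - ψ.dfn) := rfl

lemma continuous_rightEval {a : ℝ} (ha : 0 < a) (ψ : Q) : Continuous fun x => rightEval ha x ψ :=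
  continuous_inner_expKernel ha _

lemma ae_eq_rightEval {a : ℝ} (ha : 0 < a) (ψ : Q) :
    ∀ᵐ x : ℝ, x ∈ Ioi (0 : ℝ) → ψ.fn x = rightEval ha x ψ :=
  ψ.hasWeakDerivOn_Ioi.ae_eq_inner_expKernel ha

lemma ae_eq_rightEval_reflect {a : ℝ} (ha : 0 < a) (ψ : Q) :
    ∀ᵐ x : ℝ, x ∈ Iio (0 : ℝ) → ψ.fn x = rightEval ha (-x) (reflect ψ) := by
  filter_upwards [ae_neg (ae_eq_rightEval ha (reflect ψ)), ae_neg (coeFn_reflL2 ψ.fn)]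
    with x h₁ h₂ hx
  rw [← h₁ (mem_Ioi.2 (neg_pos.2 hx)), fn_reflect, h₂, neg_neg]

lemma norm_rightEval_sq_le {a : ℝ} (ha : 0 < a) (x : ℝ) (ψ : Q) :
    ‖rightEval ha x ψ‖ ^ 2 ≤ a * ‖ψ.fn‖ ^ 2 + a⁻¹ * ‖ψ.dfn‖ ^ 2 := by
  have hsub : ‖(a : ℂ) • ψ.fn - ψ.dfn‖ ≤ a * ‖ψ.fn‖ + ‖ψ.dfn‖ := by
    refine (norm_sub_le _ _).trans_eq ?_
    rw [norm_smul, Complex.norm_real, Real.norm_of_nonneg ha.le]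
  calc ‖rightEval ha x ψ‖ ^ 2 ≤ (‖expKernel ha x‖ * (a * ‖ψ.fn‖ + ‖ψ.dfn‖)) ^ 2 := by
        refine pow_le_pow_left₀ (norm_nonneg _) ?_ 2
        exact (norm_inner_le_norm (𝕜 := ℂ) _ _).trans
          (mul_le_mul_of_nonneg_left hsub (norm_nonneg _))
    _ = 1 / (2 * a) * (a * ‖ψ.fn‖ + ‖ψ.dfn‖) ^ 2 := by rw [mul_pow, norm_expKernel_sq]
    _ ≤ 1 / (2 * a) * (2 * ((a * ‖ψ.fn‖) ^ 2 + ‖ψ.dfn‖ ^ 2)) := by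
        gcongr
        exact add_sq_le
    _ = a * ‖ψ.fn‖ ^ 2 + a⁻¹ * ‖ψ.dfn‖ ^ 2 := by field_simp

lemma neBot_nhdsWithin_inf_ae {s : Set ℝ} (hs : IsOpen s) {x : ℝ} (hx : x ∈ closure s) :
    NeBot (𝓝[s] x ⊓ ae volume) := by
  refine inf_neBot_iff.2 fun t ht r hr => ?_
  obtain ⟨U, hU, hxU, hsub⟩ := mem_nhdsWithin.1 ht
  obtain ⟨y, hy, hyr⟩ := (Measure.dense_of_ae hr).inter_open_nonempty (U ∩ s) (hU.inter hs)
    (mem_closure_iff.1 hx U hU hxU)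
  exact ⟨y, hsub hy, hyr⟩

lemma limUnder_nhdsWithin_inf_ae_eq {s : Set ℝ} (hs : IsOpen s) {x : ℝ} (hx : x ∈ closure s)
    {u F : ℝ → ℂ} {c : ℂ} (h : ∀ᵐ y : ℝ, y ∈ s → u y = F y) (hF : Tendsto F (𝓝[s] x) (𝓝 c)) :
    limUnder (𝓝[s] x ⊓ ae volume) u = c := by
  have := neBot_nhdsWithin_inf_ae hs hx
  have hs' : ∀ᶠ y in 𝓝[s] x ⊓ ae volume, y ∈ s := mem_inf_of_left self_mem_nhdsWithin
  refine ((hF.mono_left inf_le_left).congr' ?_).limUnder_eq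
  filter_upwards [hs', mem_inf_of_right h] with y hy hy'
  exact (hy' hy).symm

lemma rightValue_eq_of_ae {ψ : Q} {F : ℝ → ℂ} {c : ℂ}
    (h : ∀ᵐ x : ℝ, x ∈ Ioi (0 : ℝ) → ψ.fn x = F x) (hF : Tendsto F (𝓝[>] 0) (𝓝 c)) :
    ψ.rightValue = c :=
  limUnder_nhdsWithin_inf_ae_eq isOpen_Ioi (by rw [closure_Ioi]; exact self_mem_Ici) h hF

lemma leftValue_eq_of_ae {ψ : Q} {F : ℝ → ℂ} {c : ℂ}
    (h : ∀ᵐ x : ℝ, x ∈ Iio (0 : ℝ) → ψ.fn x = F x) (hF : Tendsto F (𝓝[<] 0) (𝓝 c)) :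
    ψ.leftValue = c :=
  limUnder_nhdsWithin_inf_ae_eq isOpen_Iio (by rw [closure_Iio]; exact self_mem_Iic) h hF

lemma rightValue_eq {a : ℝ} (ha : 0 < a) (ψ : Q) : ψ.rightValue = rightEval ha 0 ψ :=
  rightValue_eq_of_ae (ae_eq_rightEval ha ψ)
    ((continuous_rightEval ha ψ).continuousAt.mono_left nhdsWithin_le_nhds)

lemma leftValue_eq {a : ℝ} (ha : 0 < a) (ψ : Q) :
    ψ.leftValue = rightEval ha 0 (reflect ψ) := by
  have hcont := ((continuous_rightEval ha (reflect ψ)).comp continuous_neg).tendsto 0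
  rw [Function.comp_apply, neg_zero] at hcont
  exact leftValue_eq_of_ae (ae_eq_rightEval_reflect ha ψ) (hcont.mono_left nhdsWithin_le_nhds)

lemma rightValue_reflect (ψ : Q) : (reflect ψ).rightValue = ψ.leftValue := by
  rw [rightValue_eq one_pos, leftValue_eq one_pos]

lemma leftValue_reflect (ψ : Q) : (reflect ψ).leftValue = ψ.rightValue := by
  rw [← rightValue_reflect, reflect_reflect]

/-- The value at `x ≠ 0` of the continuous representative. -/
def evalL (x : ℝ) : Q →L[ℂ] ℂ :=
  if 0 < x then rightEval one_pos x else
    rightEval one_pos (-x) ∘L reflect.toContinuousLinearMap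

lemma evalL_of_pos {x : ℝ} (hx : 0 < x) (ψ : Q) : evalL x ψ = rightEval one_pos x ψ := by
  rw [evalL, if_pos hx]

lemma evalL_of_neg {x : ℝ} (hx : x < 0) (ψ : Q) :
    evalL x ψ = rightEval one_pos (-x) (reflect ψ) := by
  rw [evalL, if_neg (not_lt.2 hx.le)]
  rfl

lemma ae_eq_evalL (ψ : Q) : ∀ᵐ x : ℝ, ψ.fn x = evalL x ψ := by
  filter_upwards [ae_eq_rightEval one_pos ψ, ae_eq_rightEval_reflect one_pos ψ, volume.ae_ne 0]
    with x hpos hneg h0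
  rcases lt_or_gt_of_ne h0 with h | h
  · rw [evalL_of_neg h, hneg h]
  · rw [evalL_of_pos h, hpos h]

lemma continuousAt_evalL (ψ : Q) {x : ℝ} (hx : x ≠ 0) : ContinuousAt (fun y => evalL y ψ) x := by
  rcases lt_or_gt_of_ne hx with h | h
  · refine ((continuous_rightEval one_pos (reflect ψ)).comp continuous_neg).continuousAt.congr ?_
    filter_upwards [Iio_mem_nhds h] with y hy
    exact (evalL_of_neg hy ψ).symm
  · refine (continuous_rightEval one_pos ψ).continuousAt.congr ?_
    filter_upwards [Ioi_mem_nhds h] with y hy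
    exact (evalL_of_pos hy ψ).symm

lemma norm_evalL_le (x : ℝ) (ψ : Q) : ‖evalL x ψ‖ ≤ ‖ψ‖ := by
  have hright : ∀ y φ, ‖rightEval one_pos y φ‖ ≤ ‖φ‖ := fun y φ => by
    have := norm_rightEval_sq_le one_pos y φ
    rw [inv_one, one_mul, one_mul, ← Q.norm_sq] at this
    exact le_of_sq_le_sq this (norm_nonneg _)
  rw [evalL]
  split_ifs
  · exact hright x ψ
  · exact (hright (-x) (reflect ψ)).trans_eq (reflect.norm_map ψ)

lemma ae_norm_fn_le (ψ : Q) : ∀ᵐ x : ℝ, ‖ψ.fn x‖ ≤ ‖ψ‖ := by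
  filter_upwards [ae_eq_evalL ψ] with x hx
  exact hx ▸ norm_evalL_le x ψ

/-- The boundary value `ψ(0+)` as a bounded functional. -/
def rightValueL : Q →L[ℂ] ℂ := rightEval one_pos 0

/-- The boundary value `ψ(0-)` as a bounded functional. -/
def leftValueL : Q →L[ℂ] ℂ := rightEval one_pos 0 ∘L reflect.toContinuousLinearMap

/-- The jump `ψ(0+) - ψ(0-)` as a bounded functional. -/
def jumpL : Q →L[ℂ] ℂ := rightValueL - leftValueL

lemma rightValueL_apply (ψ : Q) : rightValueL ψ = ψ.rightValue := (rightValue_eq one_pos ψ).symm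

lemma leftValueL_apply (ψ : Q) : leftValueL ψ = ψ.leftValue := (leftValue_eq one_pos ψ).symm

lemma jumpL_apply (ψ : Q) : jumpL ψ = ψ.rightValue - ψ.leftValue := by
  rw [← rightValueL_apply, ← leftValueL_apply]
  rfl

/-! ### Decomposition into half-lines -/

/-- The restriction to the right half-line, extended by zero. -/
def restrRight (u : L2) : L2 := restrL2 (measurableSet_Ioi (a := 0)) u

lemma ae_restrRight_eq (u : L2) : ∀ᵐ x, x ∈ Ioi 0 → restrRight u x = u x :=
  (coeFn_restrL2 _ _).mono fun _ hx h => hx.trans (indicator_of_mem h _)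

lemma ae_restrRight_eq_zero (u : L2) : ∀ᵐ x, x ∈ Iio 0 → restrRight u x = 0 :=
  (coeFn_restrL2 _ _).mono fun x hx (h : x < 0) => hx.trans (indicator_of_notMem h.not_gt _)

lemma ae_sub_restrRight_eq_zero (u : L2) : ∀ᵐ x, x ∈ Ioi 0 → (u - restrRight u) x = 0 :=
  (coeFn_sub_restrL2 _ _).mono fun _ hx h =>
    hx.trans (indicator_of_notMem (notMem_compl_iff.2 h) _)

/-- The part of `ψ` on the right half-line. -/
def Q.rightPart (ψ : Q) : Q :=
  Q.ofWeakDeriv (restrRight ψ.fn) (restrRight ψ.dfn)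
    (ψ.hasWeakDerivOn_Ioi.congr (ae_restrRight_eq _) (ae_restrRight_eq _))
    (.of_ae_eq_zero (ae_restrRight_eq_zero _) (ae_restrRight_eq_zero _))

lemma fn_rightPart (ψ : Q) : ψ.rightPart.fn = restrRight ψ.fn := rfl

lemma dfn_rightPart (ψ : Q) : ψ.rightPart.dfn = restrRight ψ.dfn := rfl

/-- The part of `ψ` on the left half-line. -/
def Q.leftPart (ψ : Q) : Q := ψ - ψ.rightPart

lemma fn_leftPart (ψ : Q) : ψ.leftPart.fn = ψ.fn - restrRight ψ.fn := rfl

lemma dfn_leftPart (ψ : Q) : ψ.leftPart.dfn = ψ.dfn - restrRight ψ.dfn := rfl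

lemma rightValue_rightPart (ψ : Q) : ψ.rightPart.rightValue = ψ.rightValue := by
  rw [rightValue_eq one_pos ψ]
  refine rightValue_eq_of_ae ?_
    ((continuous_rightEval one_pos ψ).continuousAt.mono_left nhdsWithin_le_nhds)
  filter_upwards [ae_eq_rightEval one_pos ψ, ae_restrRight_eq ψ.fn] with x h₁ h₂ hx
  rw [fn_rightPart, h₂ hx, h₁ hx]

lemma leftValue_rightPart (ψ : Q) : ψ.rightPart.leftValue = 0 :=
  leftValue_eq_of_ae (ae_restrRight_eq_zero ψ.fn) tendsto_const_nhds

lemma rightValue_leftPart (ψ : Q) : ψ.leftPart.rightValue = 0 := by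
  rw [← rightValueL_apply, Q.leftPart, map_sub, rightValueL_apply, rightValueL_apply,
    rightValue_rightPart, sub_self]

lemma leftValue_leftPart (ψ : Q) : ψ.leftPart.leftValue = ψ.leftValue := by
  rw [← leftValueL_apply, Q.leftPart, map_sub, leftValueL_apply, leftValueL_apply,
    leftValue_rightPart, sub_zero]

lemma norm_fn_rightPart_sq_add (ψ : Q) :
    ‖ψ.rightPart.fn‖ ^ 2 + ‖ψ.leftPart.fn‖ ^ 2 = ‖ψ.fn‖ ^ 2 :=
  norm_restrL2_sq_add measurableSet_Ioi ψ.fn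

lemma norm_dfn_rightPart_sq_add (ψ : Q) :
    ‖ψ.rightPart.dfn‖ ^ 2 + ‖ψ.leftPart.dfn‖ ^ 2 = ‖ψ.dfn‖ ^ 2 :=
  norm_restrL2_sq_add measurableSet_Ioi ψ.dfn

lemma norm_rightValue_sq_add_norm_leftValue_sq_le {a : ℝ} (ha : 0 < a) (ψ : Q) :
    ‖ψ.rightValue‖ ^ 2 + ‖ψ.leftValue‖ ^ 2 ≤ a * ‖ψ.fn‖ ^ 2 + a⁻¹ * ‖ψ.dfn‖ ^ 2 := by
  have hright := norm_rightEval_sq_le ha 0 ψ.rightPart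
  rw [← rightValue_eq, rightValue_rightPart] at hright
  have hleft := norm_rightEval_sq_le ha 0 (reflect ψ.leftPart)
  rw [← leftValue_eq, leftValue_leftPart, fn_reflect, dfn_reflect, norm_neg, reflL2.norm_map,
    reflL2.norm_map] at hleft
  rw [← norm_fn_rightPart_sq_add, ← norm_dfn_rightPart_sq_add]
  linarith

lemma norm_jump_sq_le {a : ℝ} (ha : 0 < a) (ψ : Q) :
    ‖ψ.rightValue - ψ.leftValue‖ ^ 2 ≤ 2 * (a * ‖ψ.fn‖ ^ 2 + a⁻¹ * ‖ψ.dfn‖ ^ 2) :=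
  calc ‖ψ.rightValue - ψ.leftValue‖ ^ 2 ≤ (‖ψ.rightValue‖ + ‖ψ.leftValue‖) ^ 2 :=
        pow_le_pow_left₀ (norm_nonneg _) (norm_sub_le _ _) 2
    _ ≤ 2 * (‖ψ.rightValue‖ ^ 2 + ‖ψ.leftValue‖ ^ 2) := add_sq_le
    _ ≤ 2 * (a * ‖ψ.fn‖ ^ 2 + a⁻¹ * ‖ψ.dfn‖ ^ 2) := by
        exact mul_le_mul_of_nonneg_left
          (norm_rightValue_sq_add_norm_leftValue_sq_le ha ψ) zero_le_two

/-! ### Prescribed boundary values, and translation -/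

lemma coeFn_expKernel_one_zero :
    ∀ᵐ x, expKernel one_pos 0 x = (Ioi 0).indicator (fun s => ((Real.exp (-s) : ℝ) : ℂ)) x := by
  filter_upwards [coeFn_expKernel one_pos 0] with x hx
  simpa only [mul_zero, Real.exp_zero, one_mul] using hx

lemma hasWeakDerivOn_expKernel :
    HasWeakDerivOn (Ioi 0) (expKernel one_pos 0) (-expKernel one_pos 0) := fun φ hφ hc hs => by
  have hexp : IntegrableOn (fun s : ℝ => ((Real.exp (-s) : ℝ) : ℂ)) (Ioi 0) :=
    (integrableOn_exp_neg_Ioi 0).ofReal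
  have htail : ∀ x : ℝ, ∫ s in Ioi x, ((Real.exp (-s) : ℝ) : ℂ) = (Real.exp (-x) : ℝ) := fun x => by
    rw [integral_complex_ofReal, integral_exp_neg_Ioi]
  have hker : ∀ {ξ : ℝ → ℝ}, tsupport ξ ⊆ Ioi 0 →
      ∫ x, ξ x • expKernel one_pos 0 x = ∫ x in Ioi 0, ξ x • ((Real.exp (-x) : ℝ) : ℂ) :=
    fun hξ => by
      rw [← setIntegral_smul_eq_integral hξ]
      refine setIntegral_congr_ae measurableSet_Ioi ?_
      filter_upwards [coeFn_expKernel_one_zero] with x hx h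
      rw [hx, indicator_of_mem h]
  have hneg : ∫ x, φ x • (-expKernel one_pos 0 : L2) x = -∫ x, φ x • expKernel one_pos 0 x := by
    rw [← integral_neg]
    refine integral_congr_ae ?_
    filter_upwards [Lp.coeFn_neg (expKernel one_pos 0)] with x hx
    rw [hx, Pi.neg_apply, smul_neg]
  have key := integral_Ioi_deriv_smul_integral_Ioi (hφ.of_le (by simp)) hc hexp
  simp_rw [htail] at key
  rw [hneg, neg_neg, hker (tsupport_deriv_subset.trans hs), hker hs, key,
    image_eq_zero_of_notMem_tsupport fun h => lt_irrefl (0 : ℝ) (hs h), zero_smul, sub_zero]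

/-- The function equal to `e^{-x}` on the right half-line and `0` on the left one. -/
def rightUnit : Q :=
  Q.ofWeakDeriv (expKernel one_pos 0) (-expKernel one_pos 0) hasWeakDerivOn_expKernel <|
    have hzero : ∀ᵐ x, x ∈ Iio 0 → expKernel one_pos 0 x = 0 :=
      coeFn_expKernel_one_zero.mono fun x hx (h : x < 0) =>
        hx.trans (indicator_of_notMem h.not_gt _)
    .of_ae_eq_zero hzero <| by
      filter_upwards [hzero, Lp.coeFn_neg (expKernel one_pos 0)] with x h₁ h₂ h
      rw [h₂, Pi.neg_apply, h₁ h, neg_zero]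

lemma rightValue_rightUnit : rightUnit.rightValue = 1 := by
  refine rightValue_eq_of_ae (F := fun x => ((Real.exp (-x) : ℝ) : ℂ)) ?_ ?_
  · exact coeFn_expKernel_one_zero.mono fun x hx h => hx.trans (indicator_of_mem h _)
  · have hcont : Continuous fun x : ℝ => ((Real.exp (-x) : ℝ) : ℂ) := by fun_prop
    simpa using (hcont.tendsto 0).mono_left nhdsWithin_le_nhds

lemma leftValue_rightUnit : rightUnit.leftValue = 0 :=
  leftValue_eq_of_ae (F := fun _ => 0)
    (coeFn_expKernel_one_zero.mono fun x hx (h : x < 0) =>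
      hx.trans (indicator_of_notMem h.not_gt _))
    tendsto_const_nhds

/-- The function equal to `e^{x}` on the left half-line and `0` on the right one. -/
def leftUnit : Q := reflect rightUnit

lemma rightValue_leftUnit : leftUnit.rightValue = 0 := by
  rw [leftUnit, rightValue_reflect, leftValue_rightUnit]

lemma leftValue_leftUnit : leftUnit.leftValue = 1 := by
  rw [leftUnit, leftValue_reflect, rightValue_rightUnit]

lemma hasWeakDerivOn_univ_of_ae_eq_zero {ψ : Q} (h0 : ψ.rightValue = 0)
    (hu : ∀ᵐ x, x ∈ Iio 0 → ψ.fn x = 0) (hv : ∀ᵐ x, x ∈ Iio 0 → ψ.dfn x = 0) :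
    HasWeakDerivOn univ ψ.fn ψ.dfn := fun φ hφ hc _ => by
  have hset : ∀ {ξ : ℝ → ℝ} {w : L2}, (∀ᵐ x, x ∈ Iio 0 → w x = 0) →
      ∫ x, ξ x • w x = ∫ x in Ioi 0, ξ x • w x := fun hw => by
    refine (setIntegral_eq_integral_of_ae_compl_eq_zero ?_).symm
    filter_upwards [hw, volume.ae_ne 0] with x hx hne hxI
    rw [hx (lt_of_le_of_ne (not_lt.1 hxI) hne), smul_zero]
  rw [hset hu, hset hv, ψ.hasWeakDerivOn_Ioi.setIntegral_Ioi_deriv_smul one_pos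
    (hφ.of_le (by simp)) hc, ← rightEval_apply, ← rightValue_eq, h0, smul_zero, sub_zero]

lemma hasWeakDerivOn_univ {ψ : Q} (hr : ψ.rightValue = 0) (hl : ψ.leftValue = 0) :
    HasWeakDerivOn univ ψ.fn ψ.dfn := by
  have hright : HasWeakDerivOn univ ψ.rightPart.fn ψ.rightPart.dfn :=
    hasWeakDerivOn_univ_of_ae_eq_zero ((rightValue_rightPart ψ).trans hr)
      (ae_restrRight_eq_zero _) (ae_restrRight_eq_zero _)
  have hzero : ∀ u : L2, ∀ᵐ x, x ∈ Iio 0 → reflL2 (u - restrRight u) x = 0 := fun u => by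
    filter_upwards [coeFn_reflL2 (u - restrRight u), ae_neg (ae_sub_restrRight_eq_zero u)]
      with x h₁ h₂ h
    exact h₁.trans (h₂ (mem_Ioi.2 (neg_pos.2 h)))
  have hleft : HasWeakDerivOn univ (reflect ψ.leftPart).fn (reflect ψ.leftPart).dfn := by
    refine hasWeakDerivOn_univ_of_ae_eq_zero ?_ (hzero ψ.fn) ?_
    · rw [rightValue_reflect, leftValue_leftPart, hl]
    · filter_upwards [hzero ψ.dfn, Lp.coeFn_neg (reflL2 ψ.leftPart.dfn)] with x h₁ h₂ h
      exact h₂.trans (neg_eq_zero.2 (h₁ h))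
  have hleft' := hleft.refl (Ω' := univ) fun x _ => mem_univ (-x)
  rw [← fn_reflect, ← dfn_reflect, reflect_reflect] at hleft'
  have hsum := hright.add hleft'
  rwa [fn_rightPart, fn_leftPart, dfn_rightPart, dfn_leftPart, add_sub_cancel,
    add_sub_cancel] at hsum

/-- The translate `ψ(· + t)` of a function with vanishing boundary values. -/
def Q.transl (ψ : Q) (hr : ψ.rightValue = 0) (hl : ψ.leftValue = 0) (t : ℝ) : Q :=
  Q.ofWeakDeriv (translL2 t ψ.fn) (translL2 t ψ.dfn)
    (((hasWeakDerivOn_univ hr hl).transl t).mono (subset_univ _))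
    (((hasWeakDerivOn_univ hr hl).transl t).mono (subset_univ _))

lemma ae_fn_transl_eq {ψ : Q} (hr : ψ.rightValue = 0) (hl : ψ.leftValue = 0) (t : ℝ) :
    ∀ᵐ x : ℝ, (ψ.transl hr hl t).fn x = evalL (x + t) ψ := by
  have hq := (measurePreserving_add_right (volume : Measure ℝ) t).quasiMeasurePreserving
  filter_upwards [coeFn_translL2 t ψ.fn, hq.ae (ae_eq_evalL ψ)] with x h₁ h₂
  exact h₁.trans h₂

lemma tendsto_evalL_add (ψ : Q) {t : ℝ} (ht : t ≠ 0) :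
    Tendsto (fun x => evalL (x + t) ψ) (𝓝 0) (𝓝 (evalL t ψ)) := by
  have hadd : Tendsto (fun x : ℝ => x + t) (𝓝 0) (𝓝 t) := by
    simpa only [zero_add] using (continuous_add_const t).tendsto 0
  exact (continuousAt_evalL ψ ht).tendsto.comp hadd

lemma rightValue_transl {ψ : Q} (hr : ψ.rightValue = 0) (hl : ψ.leftValue = 0) {t : ℝ}
    (ht : t ≠ 0) : (ψ.transl hr hl t).rightValue = evalL t ψ :=
  rightValue_eq_of_ae ((ae_fn_transl_eq hr hl t).mono fun _ hx _ => hx)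
    ((tendsto_evalL_add ψ ht).mono_left nhdsWithin_le_nhds)

lemma leftValue_transl {ψ : Q} (hr : ψ.rightValue = 0) (hl : ψ.leftValue = 0) {t : ℝ}
    (ht : t ≠ 0) : (ψ.transl hr hl t).leftValue = evalL t ψ :=
  leftValue_eq_of_ae ((ae_fn_transl_eq hr hl t).mono fun _ hx _ => hx)
    ((tendsto_evalL_add ψ ht).mono_left nhdsWithin_le_nhds)

/-! ### The power functional -/

lemma rpow_le_rpow_mul_sq {p t M : ℝ} (hp : 2 ≤ p) (ht : t ∈ Icc 0 M) :
    t ^ p ≤ M ^ (p - 2) * t ^ 2 :=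
  calc t ^ p = t ^ (p - 2) * t ^ 2 := by
        rw [← Real.rpow_two, ← Real.rpow_add_of_nonneg ht.1 (sub_nonneg.2 hp) zero_le_two,
          sub_add_cancel]
    _ ≤ M ^ (p - 2) * t ^ 2 := mul_le_mul_of_nonneg_right
        (Real.rpow_le_rpow ht.1 ht.2 (sub_nonneg.2 hp)) (sq_nonneg t)

lemma abs_rpow_sub_rpow_le {p s t M : ℝ} (hp : 2 ≤ p) (hs : s ∈ Icc 0 M) (ht : t ∈ Icc 0 M) :
    |s ^ p - t ^ p| ≤ p / 2 * M ^ (p - 2) * |s ^ 2 - t ^ 2| := by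
  have hsq : ∀ {r q : ℝ}, 0 ≤ r → (r ^ 2) ^ q = r ^ (2 * q) := fun hr => by
    rw [← Real.rpow_two, ← Real.rpow_mul hr]
  have hmem : ∀ {r}, r ∈ Icc 0 M → r ^ 2 ∈ Icc 0 (M ^ 2) := fun hr =>
    ⟨sq_nonneg _, pow_le_pow_left₀ hr.1 hr.2 2⟩
  have hderiv : ∀ r ∈ Icc 0 (M ^ 2), ‖p / 2 * r ^ (p / 2 - 1)‖ ≤ p / 2 * M ^ (p - 2) := by
    intro r hr
    rw [Real.norm_of_nonneg (mul_nonneg (by linarith) (Real.rpow_nonneg hr.1 _)),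
      show p - 2 = 2 * (p / 2 - 1) by ring, ← hsq (hs.1.trans hs.2)]
    gcongr
    · exact hr.1
    · linarith
    · exact hr.2
  have hmvt := (convex_Icc 0 (M ^ 2)).norm_image_sub_le_of_norm_hasDerivWithin_le
    (fun r _ => (Real.hasDerivAt_rpow_const (Or.inr (by linarith))).hasDerivWithinAt) hderiv
    (hmem ht) (hmem hs)
  simpa only [hsq hs.1, hsq ht.1, mul_div_cancel₀ p (two_ne_zero' ℝ), Real.norm_eq_abs] using hmvt

lemma abs_sq_sub_sq_le {ε s t b : ℝ} (hε : 0 < ε) (hs : 0 ≤ s) (ht : 0 ≤ t) (hb : |s - t| ≤ b) :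
    |s ^ 2 - t ^ 2| ≤ ε * t ^ 2 + (1 + ε⁻¹) * b ^ 2 := by
  have hb0 : 0 ≤ b := (abs_nonneg _).trans hb
  calc |s ^ 2 - t ^ 2| = (s + t) * |s - t| := by
        rw [sq_sub_sq, abs_mul, abs_of_nonneg (add_nonneg hs ht)]
    _ ≤ (2 * t + b) * b := by
        refine mul_le_mul ?_ hb (abs_nonneg _) (by positivity)
        linarith [(abs_le.1 hb).2]
    _ = ε * t ^ 2 + (1 + ε⁻¹) * b ^ 2 - ε⁻¹ * (ε * t - b) ^ 2 := by
        field_simp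
        ring
    _ ≤ ε * t ^ 2 + (1 + ε⁻¹) * b ^ 2 := sub_le_self _ (by positivity)

lemma exists_abs_rpow_sub_rpow_add_le {p M ε : ℝ} (hp : 2 ≤ p) (hM : 0 ≤ M) (hε : 0 < ε) :
    ∃ C, ∀ s ∈ Icc 0 M, ∀ t ∈ Icc 0 M, ∀ b ∈ Icc 0 M, |s - t| ≤ b →
      |s ^ p - t ^ p| + b ^ p ≤ ε * t ^ 2 + C * b ^ 2 := by
  set K := p / 2 * M ^ (p - 2)
  have hK0 : 0 ≤ K := mul_nonneg (by linarith) (Real.rpow_nonneg hM _)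
  set η := ε / (K + 1) with hη
  have hη0 : 0 < η := by positivity
  have hKη : K * η ≤ ε := by
    rw [hη, mul_div_assoc', div_le_iff₀ (by positivity)]
    nlinarith
  refine ⟨K * (1 + η⁻¹) + M ^ (p - 2), fun s hs t ht b hb hst => ?_⟩
  calc |s ^ p - t ^ p| + b ^ p
      ≤ K * (η * t ^ 2 + (1 + η⁻¹) * b ^ 2) + M ^ (p - 2) * b ^ 2 := add_le_add
        ((abs_rpow_sub_rpow_le hp hs ht).trans
          (mul_le_mul_of_nonneg_left (abs_sq_sub_sq_le hη0 hs.1 ht.1 hst) hK0))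
        (rpow_le_rpow_mul_sq hp hb)
    _ = K * η * t ^ 2 + (K * (1 + η⁻¹) + M ^ (p - 2)) * b ^ 2 := by ring
    _ ≤ ε * t ^ 2 + (K * (1 + η⁻¹) + M ^ (p - 2)) * b ^ 2 := by gcongr

lemma integrable_norm_sq (u : L2) : Integrable fun x => ‖u x‖ ^ 2 :=
  (Lp.memLp u).integrable_norm_pow two_ne_zero

lemma integrable_norm_rpow {p M : ℝ} (hp : 2 ≤ p) {u : L2} (h : ∀ᵐ x : ℝ, ‖u x‖ ≤ M) :
    Integrable fun x => ‖u x‖ ^ p := by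
  have hcont : Continuous fun t : ℝ => t ^ p := Real.continuous_rpow_const (by linarith)
  refine ((integrable_norm_sq u).const_mul (M ^ (p - 2))).mono'
    (hcont.comp_aestronglyMeasurable (Lp.aestronglyMeasurable u).norm) ?_
  filter_upwards [h] with x hx
  rw [Real.norm_of_nonneg (Real.rpow_nonneg (norm_nonneg _) _)]
  exact rpow_le_rpow_mul_sq hp ⟨norm_nonneg _, hx⟩

lemma integrable_norm_fn_rpow {p : ℝ} (hp : 2 ≤ p) (ψ : Q) : Integrable fun x => ‖ψ.fn x‖ ^ p :=
  integrable_norm_rpow hp (ae_norm_fn_le ψ)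

lemma Q.norm_fn_le (ψ : Q) : ‖ψ.fn‖ ≤ ‖ψ‖ := by
  rw [← sq_le_sq₀ (norm_nonneg _) (norm_nonneg _), Q.norm_sq]
  exact le_add_of_nonneg_right (sq_nonneg _)

lemma powerNorm_nonneg (μ : ℝ) (ψ : Q) : 0 ≤ powerNorm μ ψ :=
  integral_nonneg fun _ => Real.rpow_nonneg (norm_nonneg _) _

lemma powerNorm_le_of_ae_norm_le {μ M : ℝ} (hμ : 0 ≤ μ) {ψ : Q} (h : ∀ᵐ x : ℝ, ‖ψ.fn x‖ ≤ M) :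
    powerNorm μ ψ ≤ M ^ (2 * μ) * ‖ψ.fn‖ ^ 2 := by
  have hp : 2 ≤ 2 * μ + 2 := by linarith
  rw [Lp_two_norm_sq, ← integral_const_mul]
  refine integral_mono_ae (integrable_norm_rpow hp h) ((integrable_norm_sq _).const_mul _) ?_
  filter_upwards [h] with x hx
  simpa only [add_sub_cancel_right] using rpow_le_rpow_mul_sq hp ⟨norm_nonneg _, hx⟩

lemma powerNorm_le {μ : ℝ} (hμ : 0 ≤ μ) (ψ : Q) : powerNorm μ ψ ≤ ‖ψ‖ ^ (2 * μ) * ‖ψ‖ ^ 2 := by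
  refine (powerNorm_le_of_ae_norm_le hμ (ae_norm_fn_le ψ)).trans ?_
  gcongr
  exact ψ.norm_fn_le

lemma powerNorm_smul (μ : ℝ) (c : ℂ) (ψ : Q) :
    powerNorm μ (c • ψ) = ‖c‖ ^ (2 * μ + 2) * powerNorm μ ψ := by
  rw [powerNorm, powerNorm, ← integral_const_mul]
  refine integral_congr_ae ?_
  filter_upwards [Lp.coeFn_smul c ψ.fn] with x hx
  change ‖(c • ψ.fn) x‖ ^ (2 * μ + 2) = _
  rw [hx, Pi.smul_apply, norm_smul, Real.mul_rpow (norm_nonneg _) (norm_nonneg _)]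

lemma powerNorm_rightPart_add {μ : ℝ} (hμ : 0 ≤ μ) (ψ : Q) :
    powerNorm μ ψ.rightPart + powerNorm μ ψ.leftPart = powerNorm μ ψ :=
  integral_comp_norm_restrL2_add measurableSet_Ioi ψ.fn (F := fun r => r ^ (2 * μ + 2))
    (Real.zero_rpow (by linarith)) (integrable_norm_fn_rpow (by linarith) ψ)

lemma powerNorm_transl (μ : ℝ) {ψ : Q} (hr : ψ.rightValue = 0) (hl : ψ.leftValue = 0) (t : ℝ) :
    powerNorm μ (ψ.transl hr hl t) = powerNorm μ ψ := by
  rw [powerNorm, powerNorm, ← integral_add_right_eq_self (fun x => ‖ψ.fn x‖ ^ (2 * μ + 2)) t]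
  refine integral_congr_ae ?_
  filter_upwards [coeFn_translL2 t ψ.fn] with x hx
  exact congrArg (fun z : ℂ => ‖z‖ ^ (2 * μ + 2)) hx

lemma HasWeakDerivOn.ae_eq_zero {Ω : Set ℝ} (hΩ : IsOpen Ω) {v : L2}
    (h : HasWeakDerivOn Ω 0 v) : ∀ᵐ x : ℝ, x ∈ Ω → v x = 0 := by
  have hloc : LocallyIntegrable (fun x => v x) := (Lp.memLp v).locallyIntegrable one_le_two
  refine hΩ.ae_eq_zero_of_integral_contDiff_smul_eq_zero (hloc.locallyIntegrableOn _)
    fun φ hφ hc hs => ?_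
  rw [← neg_eq_zero, ← h φ hφ hc hs]
  refine integral_eq_zero_of_ae ?_
  filter_upwards [Lp.coeFn_zero ℂ 2 (volume : Measure ℝ)] with x hx
  rw [hx, Pi.zero_apply, smul_zero]

lemma eq_zero_of_fn_eq_zero {ψ : Q} (h : ψ.fn = 0) : ψ = 0 := by
  refine Q.ext_fn h (Lp.ext ?_)
  filter_upwards [(h ▸ ψ.hasWeakDerivOn_Ioi).ae_eq_zero isOpen_Ioi,
    (h ▸ ψ.hasWeakDerivOn_Iio).ae_eq_zero isOpen_Iio, volume.ae_ne 0,
    Lp.coeFn_zero ℂ 2 (volume : Measure ℝ)] with x hright hleft hx hzero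
  exact (hx.lt_or_gt.elim hleft hright).trans hzero.symm

lemma powerNorm_pos {μ : ℝ} (hμ : 0 ≤ μ) {ψ : Q} (h : ψ ≠ 0) : 0 < powerNorm μ ψ := by
  refine (powerNorm_nonneg μ ψ).lt_of_ne fun h0 => h (eq_zero_of_fn_eq_zero (Lp.ext ?_))
  have hae := (integral_eq_zero_iff_of_nonneg
    (fun x => Real.rpow_nonneg (norm_nonneg (ψ.fn x)) _)
    (integrable_norm_fn_rpow (by linarith) ψ)).1 h0.symm
  filter_upwards [hae, Lp.coeFn_zero ℂ 2 (volume : Measure ℝ)] with x hx hzero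
  rw [hzero]
  exact norm_eq_zero.1 ((Real.rpow_eq_zero (norm_nonneg _) (by linarith)).1 hx)

lemma tendsto_zero_of_forall_abs_le_mul_add {a : ℕ → ℝ} {B : ℝ}
    (h : ∀ ε > 0, ∃ b : ℕ → ℝ, Tendsto b atTop (𝓝 0) ∧ ∀ n, |a n| ≤ ε * B + b n) :
    Tendsto a atTop (𝓝 0) := by
  refine Metric.tendsto_nhds.2 fun η hη => ?_
  have hε : η / (2 * (|B| + 1)) * B ≤ η / 2 := by
    rw [div_mul_eq_mul_div, div_le_div_iff₀ (by positivity) two_pos]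
    nlinarith [le_abs_self B]
  obtain ⟨b, hb, hab⟩ := h (η / (2 * (|B| + 1))) (by positivity)
  filter_upwards [hb.eventually_lt_const (half_pos hη)] with n hn
  rw [Real.dist_0_eq_abs]
  linarith [hab n]

lemma exists_abs_powerNorm_sub_le {μ M ε : ℝ} (hμ : 0 ≤ μ) (hM : 0 ≤ M) (hε : 0 < ε) :
    ∃ C, ∀ φ ψ : Q, ‖φ‖ ≤ M → ‖ψ‖ ≤ M →
      |powerNorm μ φ - powerNorm μ ψ| ≤ ε * ‖ψ.fn‖ ^ 2 + C * ‖(φ - ψ).fn‖ ^ 2 := by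
  have hp : 2 ≤ 2 * μ + 2 := by linarith
  obtain ⟨C, hC⟩ := exists_abs_rpow_sub_rpow_add_le (M := M + M) hp (add_nonneg hM hM) hε
  refine ⟨C, fun φ ψ hφ hψ => ?_⟩
  have hi : ∀ (r : ℝ) (u : L2), Integrable fun x => r * ‖u x‖ ^ 2 := fun r u =>
    (integrable_norm_sq u).const_mul r
  have hbound : Integrable fun x => ε * ‖ψ.fn x‖ ^ 2 + C * ‖(φ - ψ).fn x‖ ^ 2 :=
    (hi _ _).add (hi _ _)
  rw [powerNorm, powerNorm, ← integral_sub (integrable_norm_fn_rpow hp φ)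
    (integrable_norm_fn_rpow hp ψ), Lp_two_norm_sq, Lp_two_norm_sq, ← integral_const_mul,
    ← integral_const_mul, ← integral_add (hi _ _) (hi _ _), ← Real.norm_eq_abs]
  refine norm_integral_le_of_norm_le hbound ?_
  filter_upwards [ae_norm_fn_le φ, ae_norm_fn_le ψ, ae_norm_fn_le (φ - ψ),
    Lp.coeFn_sub φ.fn ψ.fn] with x h₁ h₂ h₃ hsub
  have hb : |‖φ.fn x‖ - ‖ψ.fn x‖| ≤ ‖(φ - ψ).fn x‖ :=
    (abs_norm_sub_norm_le _ _).trans_eq (congrArg norm hsub.symm)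
  exact (le_add_of_nonneg_right (Real.rpow_nonneg (norm_nonneg _) _)).trans <|
    hC _ ⟨norm_nonneg _, by linarith⟩ _ ⟨norm_nonneg _, by linarith⟩ _
      ⟨norm_nonneg _, h₃.trans ((norm_sub_le _ _).trans (add_le_add hφ hψ))⟩ hb

lemma tendsto_powerNorm_sub {μ M : ℝ} (hμ : 0 ≤ μ) {u w : ℕ → Q} (hu : ∀ n, ‖u n‖ ≤ M)
    (hw : ∀ n, ‖w n‖ ≤ M) (h : Tendsto (fun n => w n - u n) atTop (𝓝 0)) :
    Tendsto (fun n => powerNorm μ (w n) - powerNorm μ (u n)) atTop (𝓝 0) := by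
  have hM : 0 ≤ M := (norm_nonneg _).trans (hu 0)
  refine tendsto_zero_of_forall_abs_le_mul_add (B := M ^ 2) fun ε hε => ?_
  obtain ⟨C, hC⟩ := exists_abs_powerNorm_sub_le hμ hM hε
  refine ⟨fun n => C * ‖Q.fnL (w n - u n)‖ ^ 2, ?_, fun n => (hC _ _ (hw n) (hu n)).trans ?_⟩
  · simpa using (((Q.fnL.continuous.tendsto 0).comp h).norm.pow 2).const_mul C
  · exact add_le_add_left (mul_le_mul_of_nonneg_left
      (pow_le_pow_left₀ (norm_nonneg _) ((u n).norm_fn_le.trans (hu n)) 2) hε.le) _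

/-! ### Splitting along weakly convergent sequences -/

lemma WeaklyTendsto.ae_tendsto {u : ℕ → Q} {ψ : Q} (h : WeaklyTendsto u ψ) :
    ∀ᵐ x : ℝ, Tendsto (fun n => (u n).fn x) atTop (𝓝 (ψ.fn x)) := by
  filter_upwards [ae_all_iff.2 fun n => ae_eq_evalL (u n), ae_eq_evalL ψ] with x hu hψ
  simpa only [hu, hψ] using h (evalL x)

/-- Only the part of `D n` above `ε * g n` is dominated, so dominated convergence applies to it. -/
lemma tendsto_integral_zero_of_abs_le {α : Type*} [MeasurableSpace α] {ν : Measure α}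
    {D g : ℕ → α → ℝ} {h : α → ℝ} {B : ℝ} (hD : ∀ n, Integrable (D n) ν)
    (hg : ∀ n, Integrable (g n) ν) (hg0 : ∀ n x, 0 ≤ g n x) (hB : ∀ n, ∫ x, g n x ∂ν ≤ B)
    (hh : Integrable h ν)
    (hle : ∀ ε > 0, ∃ C, ∀ n, ∀ᵐ x ∂ν, |D n x| ≤ ε * g n x + C * h x)
    (hlim : ∀ᵐ x ∂ν, Tendsto (fun n => D n x) atTop (𝓝 0)) :
    Tendsto (fun n => ∫ x, D n x ∂ν) atTop (𝓝 0) := by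
  refine tendsto_zero_of_forall_abs_le_mul_add (B := B) fun ε hε => ?_
  obtain ⟨C, hC⟩ := hle ε hε
  let f : ℕ → α → ℝ := fun n x => max (|D n x| - ε * g n x) 0
  have hf : ∀ n, Integrable (f n) ν := fun n => ((hD n).abs.sub ((hg n).const_mul ε)).pos_part
  refine ⟨fun n => ∫ x, f n x ∂ν, ?_, fun n => ?_⟩
  · rw [← integral_zero α ℝ]
    refine tendsto_integral_of_dominated_convergence (fun x => |C * h x|)
      (fun n => (hf n).aestronglyMeasurable) (hh.const_mul C).abs (fun n => ?_) ?_
    · filter_upwards [hC n] with x hx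
      rw [Real.norm_of_nonneg (le_max_right _ _)]
      exact max_le ((sub_le_iff_le_add'.2 hx).trans (le_abs_self _)) (abs_nonneg _)
    · filter_upwards [hlim] with x hx
      refine squeeze_zero (fun n => le_max_right _ _) (fun n => ?_) (abs_zero (α := ℝ) ▸ hx.abs)
      exact max_le (sub_le_self _ (mul_nonneg hε.le (hg0 n x))) (abs_nonneg _)
  · have hbound : Integrable (fun x => ε * g n x + f n x) ν := ((hg n).const_mul ε).add (hf n)
    calc ‖∫ x, D n x ∂ν‖ ≤ ∫ x, (ε * g n x + f n x) ∂ν :=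
          norm_integral_le_of_norm_le hbound <| ae_of_all _ fun x =>
            sub_le_iff_le_add'.1 (le_max_left (|D n x| - ε * g n x) 0)
      _ = ε * (∫ x, g n x ∂ν) + ∫ x, f n x ∂ν := by
          rw [integral_add ((hg n).const_mul ε) (hf n), integral_const_mul]
      _ ≤ ε * B + ∫ x, f n x ∂ν := by
          gcongr
          exact hB n

/-- The Brezis–Lieb lemma. -/
lemma tendsto_powerNorm_split {μ M : ℝ} (hμ : 0 ≤ μ) {u : ℕ → Q} {ψ : Q}
    (hb : ∀ n, ‖u n‖ ≤ M) (h : WeaklyTendsto u ψ) :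
    Tendsto (fun n => powerNorm μ (u n) - powerNorm μ (u n - ψ) - powerNorm μ ψ) atTop (𝓝 0) := by
  have hp : 2 ≤ 2 * μ + 2 := by linarith
  have hM : 0 ≤ M := (norm_nonneg _).trans (hb 0)
  have hsub_le : ∀ n, ‖u n - ψ‖ ≤ M + ‖ψ‖ := fun n =>
    (norm_sub_le _ _).trans (add_le_add_left (hb n) _)
  have hsub : ∀ᵐ x : ℝ, ∀ n, (u n - ψ).fn x = (u n).fn x - ψ.fn x :=
    ae_all_iff.2 fun n => Lp.coeFn_sub (u n).fn ψ.fn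
  have hi := integrable_norm_fn_rpow hp
  have hint : ∀ n, powerNorm μ (u n) - powerNorm μ (u n - ψ) - powerNorm μ ψ =
      ∫ x, (‖(u n).fn x‖ ^ (2 * μ + 2) - ‖(u n - ψ).fn x‖ ^ (2 * μ + 2)
        - ‖ψ.fn x‖ ^ (2 * μ + 2)) := fun n => by
    have hdiff : Integrable fun x =>
        ‖(u n).fn x‖ ^ (2 * μ + 2) - ‖(u n - ψ).fn x‖ ^ (2 * μ + 2) := (hi _).sub (hi _)
    rw [integral_sub hdiff (hi _), integral_sub (hi _) (hi _)]
    rfl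
  simp_rw [hint]
  refine tendsto_integral_zero_of_abs_le (g := fun n x => ‖(u n - ψ).fn x‖ ^ 2)
    (B := (M + ‖ψ‖) ^ 2) (fun n => ((hi _).sub (hi _)).sub (hi _)) (fun n => integrable_norm_sq _)
    (fun n x => sq_nonneg _) (fun n => ?_) (integrable_norm_sq ψ.fn) (fun ε hε => ?_) ?_
  · rw [← Lp_two_norm_sq]
    exact pow_le_pow_left₀ (norm_nonneg _) ((Q.norm_fn_le _).trans (hsub_le n)) 2
  · obtain ⟨C, hC⟩ := exists_abs_rpow_sub_rpow_add_le hp (by positivity : 0 ≤ M + ‖ψ‖) hε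
    refine ⟨C, fun n => ?_⟩
    filter_upwards [hsub, ae_norm_fn_le (u n), ae_norm_fn_le (u n - ψ), ae_norm_fn_le ψ]
      with x hx h₁ h₂ h₃
    have hdiff : |‖(u n).fn x‖ - ‖(u n - ψ).fn x‖| ≤ ‖ψ.fn x‖ := by
      simpa only [hx, sub_sub_cancel] using abs_norm_sub_norm_le ((u n).fn x) ((u n - ψ).fn x)
    refine le_trans ?_ (hC _ ⟨norm_nonneg _, by linarith [hb n, norm_nonneg ψ]⟩ _
      ⟨norm_nonneg _, h₂.trans (hsub_le n)⟩ _ ⟨norm_nonneg _, by linarith⟩ hdiff)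
    exact (abs_sub _ _).trans_eq
      (congrArg _ (abs_of_nonneg (Real.rpow_nonneg (norm_nonneg _) _)))
  · filter_upwards [hsub, h.ae_tendsto] with x hx hlim
    have hcont : Continuous fun z : ℂ => ‖z‖ ^ (2 * μ + 2) - ‖z - ψ.fn x‖ ^ (2 * μ + 2)
        - ‖ψ.fn x‖ ^ (2 * μ + 2) := by
      have := Real.continuous_rpow_const (q := 2 * μ + 2) (by linarith)
      fun_prop
    have hzero : (0 : ℝ) ^ (2 * μ + 2) = 0 := Real.zero_rpow (by linarith)
    simpa only [hx, Function.comp_def, sub_self, norm_zero, hzero, sub_zero] using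
      (hcont.tendsto (ψ.fn x)).comp hlim

lemma tendsto_norm_sq_split {H : Type*} [NormedAddCommGroup H] [InnerProductSpace ℂ H]
    (T : Q →L[ℂ] H) {u : ℕ → Q} {ψ : Q} (h : WeaklyTendsto u ψ) :
    Tendsto (fun n => ‖T (u n)‖ ^ 2 - ‖T (u n - ψ)‖ ^ 2 - ‖T ψ‖ ^ 2) atTop (𝓝 0) := by
  have hinner : Tendsto (fun n => 2 * (inner ℂ (T ψ) (T (u n - ψ))).re) atTop (𝓝 0) := by
    have hℓ := (h (innerSL ℂ (T ψ) ∘L T)).sub_const ((innerSL ℂ (T ψ) ∘L T) ψ)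
    simp_rw [← map_sub, sub_self, map_zero] at hℓ
    have hre := ((Complex.continuous_re.tendsto 0).comp hℓ).const_mul 2
    rw [Complex.zero_re, mul_zero] at hre
    exact hre
  refine hinner.congr fun n => ?_
  have hexp := norm_add_sq (𝕜 := ℂ) (T ψ) (T (u n - ψ))
  rw [← map_add, add_sub_cancel] at hexp
  rw [hexp, RCLike.re_eq_complex_re]
  ring

/-! ### Weak sequential compactness -/

lemma continuous_integral_smul {φ : ℝ → ℝ} (hφ : Continuous φ) (hc : HasCompactSupport φ) :
    Continuous fun u : L2 => ∫ x, φ x • u x := by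
  have hφ2 : MemLp (fun x => (φ x : ℂ)) 2 volume :=
    (Complex.continuous_ofReal.comp hφ).memLp_of_hasCompactSupport
      (hc.comp_left Complex.ofReal_zero)
  have hinner : ∀ u : L2, ∫ x, φ x • u x = inner ℂ (hφ2.toLp _) u := fun u => by
    rw [L2.inner_def]
    refine integral_congr_ae ?_
    filter_upwards [hφ2.coeFn_toLp] with x hx
    rw [hx, RCLike.inner_apply, Complex.conj_ofReal, mul_comm, Complex.real_smul]
  simp_rw [hinner]
  fun_prop

lemma isClosed_setOf_hasWeakDerivOn (Ω : Set ℝ) :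
    IsClosed {p : WithLp 2 (L2 × L2) | HasWeakDerivOn Ω p.fst p.snd} := by
  simp only [HasWeakDerivOn, ofPred_forall]
  refine isClosed_iInter fun φ => isClosed_iInter fun hφ => isClosed_iInter fun hc =>
    isClosed_iInter fun _ => isClosed_eq ?_ ?_
  · exact (continuous_integral_smul (hφ.continuous_deriv (by simp)) hc.deriv).comp
      (WithLp.fstL 2 ℂ L2 L2).continuous
  · exact ((continuous_integral_smul hφ.continuous hc).comp
      (WithLp.sndL 2 ℂ L2 L2).continuous).neg

instance completeSpace_Q : CompleteSpace Q :=
  ((isClosed_setOf_hasWeakDerivOn _).inter (isClosed_setOf_hasWeakDerivOn _)).completeSpace_coe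

instance separableSpace_Q : TopologicalSpace.SeparableSpace Q := by
  have : Fact ((2 : ENNReal) ≠ ⊤) := ⟨ENNReal.ofNat_ne_top⟩
  have : SecondCountableTopology L2 := inferInstance
  have : SecondCountableTopology (WithLp 2 (L2 × L2)) := WithLp.secondCountableTopology 2 L2 L2
  infer_instance

lemma exists_subseq_tendsto_apply {E : Type*} [NormedAddCommGroup E] [InnerProductSpace ℂ E]
    [CompleteSpace E] [TopologicalSpace.SeparableSpace E] {u : ℕ → E} {M : ℝ}
    (hb : ∀ n, ‖u n‖ ≤ M) :
    ∃ (ψ : E) (k : ℕ → ℕ), StrictMono k ∧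
      ∀ ℓ : E →L[ℂ] ℂ, Tendsto (fun n => ℓ (u (k n))) atTop (𝓝 (ℓ ψ)) := by
  let J := InnerProductSpace.toDual ℂ E
  obtain ⟨y, -, k, hk, hy⟩ := WeakDual.isSeqCompact_closedBall ℂ E 0 M
    (x := fun n => StrongDual.toWeakDual (J (u n))) fun n =>
      mem_closedBall_zero_iff.2 ((J.norm_map _).trans_le (hb n))
  refine ⟨J.symm (WeakDual.toStrongDual y), k, hk, fun ℓ => ?_⟩
  have hℓ : ∀ v, ℓ v = starRingEnd ℂ (J v (J.symm ℓ)) := fun v => by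
    rw [InnerProductSpace.toDual_apply_apply, inner_conj_symm,
      InnerProductSpace.toDual_symm_apply]
  simp_rw [hℓ, LinearIsometryEquiv.apply_symm_apply]
  exact (Complex.continuous_conj.tendsto _).comp
    (((WeakDual.eval_continuous (J.symm ℓ)).tendsto y).comp hy)

lemma exists_weaklyTendsto_subseq {u : ℕ → Q} {M : ℝ} (hb : ∀ n, ‖u n‖ ≤ M) :
    ∃ (ψ : Q) (k : ℕ → ℕ), StrictMono k ∧ WeaklyTendsto (u ∘ k) ψ :=
  exists_subseq_tendsto_apply hb

/-! ### The Nehari functional -/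

variable {γ lam μ ω : ℝ}

/-- The quadratic part `F_γ + ω M` of the Nehari functional. -/
def nehariQuad (γ ω : ℝ) (ψ : Q) : ℝ := quadForm γ ψ + ω * mass ψ

lemma nehari_eq (γ lam μ ω : ℝ) (ψ : Q) :
    nehari γ lam μ ω ψ = nehariQuad γ ω ψ - lam * powerNorm μ ψ := rfl

lemma nehariQuad_eq (γ ω : ℝ) (ψ : Q) :
    nehariQuad γ ω ψ = ‖Q.dfnL ψ‖ ^ 2 - γ⁻¹ * ‖jumpL ψ‖ ^ 2 + ω * ‖Q.fnL ψ‖ ^ 2 := by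
  rw [jumpL_apply]
  rfl

lemma nehariQuad_smul (γ ω : ℝ) (c : ℂ) (ψ : Q) :
    nehariQuad γ ω (c • ψ) = ‖c‖ ^ 2 * nehariQuad γ ω ψ := by
  simp only [nehariQuad_eq, map_smul, norm_smul, mul_pow]
  ring

/-- Coercivity of the quadratic form `F_γ + ω M` on the energy space. -/
def Coercive (γ ω : ℝ) : Prop := ∃ c > 0, ∀ ψ : Q, c * ‖ψ‖ ^ 2 ≤ nehariQuad γ ω ψ

lemma coercive_of_lt (hγ : 0 < γ) (hω : 4 / γ ^ 2 < ω) : Coercive γ ω := by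
  have hlt : 2 * γ⁻¹ < ω / (2 * γ⁻¹) := by
    rw [lt_div_iff₀ (by positivity)]
    calc 2 * γ⁻¹ * (2 * γ⁻¹) = 4 / γ ^ 2 := by ring
      _ < ω := hω
  obtain ⟨a, hlo, hhi⟩ := exists_between hlt
  have ha : 0 < a := lt_trans (by positivity) hlo
  have hdfn : 0 < 1 - 2 * γ⁻¹ * a⁻¹ := sub_pos.2 <| (div_lt_one ha).2 hlo
  have hfn : 0 < ω - 2 * γ⁻¹ * a := sub_pos.2 <| (lt_div_iff₀' (by positivity)).1 hhi
  refine ⟨min (1 - 2 * γ⁻¹ * a⁻¹) (ω - 2 * γ⁻¹ * a), lt_min hdfn hfn, fun ψ => ?_⟩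
  calc min (1 - 2 * γ⁻¹ * a⁻¹) (ω - 2 * γ⁻¹ * a) * ‖ψ‖ ^ 2
      ≤ (ω - 2 * γ⁻¹ * a) * ‖ψ.fn‖ ^ 2 + (1 - 2 * γ⁻¹ * a⁻¹) * ‖ψ.dfn‖ ^ 2 := by
        rw [Q.norm_sq, mul_add]
        gcongr
        · exact min_le_right _ _
        · exact min_le_left _ _
    _ = ‖ψ.dfn‖ ^ 2 - γ⁻¹ * (2 * (a * ‖ψ.fn‖ ^ 2 + a⁻¹ * ‖ψ.dfn‖ ^ 2)) + ω * ‖ψ.fn‖ ^ 2 := by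
        ring
    _ ≤ nehariQuad γ ω ψ := by
        rw [nehariQuad, quadForm, mass]
        gcongr
        exact norm_jump_sq_le ha ψ

lemma tendsto_nehariQuad_split (γ ω : ℝ) {u : ℕ → Q} {ψ : Q} (h : WeaklyTendsto u ψ) :
    Tendsto (fun n => nehariQuad γ ω (u n) - nehariQuad γ ω (u n - ψ) - nehariQuad γ ω ψ)
      atTop (𝓝 0) := by
  have hlim := ((tendsto_norm_sq_split Q.dfnL h).sub
    ((tendsto_norm_sq_split jumpL h).const_mul γ⁻¹)).add
    ((tendsto_norm_sq_split Q.fnL h).const_mul ω)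
  simp only [mul_zero, sub_zero, add_zero] at hlim
  refine hlim.congr fun n => ?_
  simp only [nehariQuad_eq]
  ring

lemma tendsto_nehari_split {M : ℝ} (hμ : 0 ≤ μ) {u : ℕ → Q} {ψ : Q} (hb : ∀ n, ‖u n‖ ≤ M)
    (h : WeaklyTendsto u ψ) :
    Tendsto (fun n => nehari γ lam μ ω (u n) - nehari γ lam μ ω (u n - ψ) - nehari γ lam μ ω ψ)
      atTop (𝓝 0) := by
  have hlim := (tendsto_nehariQuad_split γ ω h).sub
    ((tendsto_powerNorm_split hμ hb h).const_mul lam)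
  rw [mul_zero, sub_zero] at hlim
  refine hlim.congr fun n => ?_
  simp only [nehari_eq]
  ring

lemma tendsto_norm_sq_sub {H : Type*} [NormedAddCommGroup H] [NormedSpace ℂ H]
    (T : Q →L[ℂ] H) {u w : ℕ → Q} {M : ℝ} (hu : ∀ n, ‖u n‖ ≤ M) (hw : ∀ n, ‖w n‖ ≤ M)
    (h : Tendsto (fun n => w n - u n) atTop (𝓝 0)) :
    Tendsto (fun n => ‖T (w n)‖ ^ 2 - ‖T (u n)‖ ^ 2) atTop (𝓝 0) := by
  have hM : 0 ≤ M := (norm_nonneg _).trans (hu 0)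
  have hlim := ((T.continuous.tendsto 0).comp h).norm.const_mul (‖T‖ * M + ‖T‖ * M)
  rw [map_zero, norm_zero, mul_zero] at hlim
  refine squeeze_zero_norm (fun n => ?_) hlim
  calc |‖T (w n)‖ ^ 2 - ‖T (u n)‖ ^ 2|
      = (‖T (w n)‖ + ‖T (u n)‖) * |‖T (w n)‖ - ‖T (u n)‖| := by
        rw [sq_sub_sq, abs_mul, abs_of_nonneg (by positivity)]
    _ ≤ (‖T‖ * M + ‖T‖ * M) * ‖T (w n - u n)‖ := by
        rw [map_sub]
        gcongr
        · exact T.le_opNorm_of_le (hw n)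
        · exact T.le_opNorm_of_le (hu n)
        · exact abs_norm_sub_norm_le _ _

lemma tendsto_nehari_sub {M : ℝ} (hμ : 0 ≤ μ) {u w : ℕ → Q} (hu : ∀ n, ‖u n‖ ≤ M)
    (hw : ∀ n, ‖w n‖ ≤ M) (h : Tendsto (fun n => w n - u n) atTop (𝓝 0)) :
    Tendsto (fun n => nehari γ lam μ ω (w n) - nehari γ lam μ ω (u n)) atTop (𝓝 0) := by
  have hlim := (((tendsto_norm_sq_sub Q.dfnL hu hw h).sub
    ((tendsto_norm_sq_sub jumpL hu hw h).const_mul γ⁻¹)).add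
    ((tendsto_norm_sq_sub Q.fnL hu hw h).const_mul ω)).sub
    ((tendsto_powerNorm_sub hμ hu hw h).const_mul lam)
  simp only [mul_zero, sub_zero, add_zero] at hlim
  refine hlim.congr fun n => ?_
  simp only [nehari_eq, nehariQuad_eq]
  ring

/-! ### The Nehari region -/

lemma nehariManifold_subset (γ lam μ ω : ℝ) :
    nehariManifold γ lam μ ω ⊆ nehariRegion γ lam μ ω := fun _ h => ⟨h.1, h.2.le⟩

lemma powerNorm_ofReal_smul (hμ : 0 ≤ μ) {α : ℝ} (hα : 0 ≤ α) (ψ : Q) :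
    powerNorm μ ((α : ℂ) • ψ) = α ^ (2 * μ) * α ^ 2 * powerNorm μ ψ := by
  rw [powerNorm_smul, Complex.norm_real, Real.norm_of_nonneg hα,
    Real.rpow_add_of_nonneg hα (by positivity) zero_le_two, Real.rpow_two]

lemma nehari_ofReal_smul (hμ : 0 ≤ μ) {α : ℝ} (hα : 0 ≤ α) (ψ : Q) :
    nehari γ lam μ ω ((α : ℂ) • ψ) =
      α ^ 2 * (nehariQuad γ ω ψ - lam * (α ^ (2 * μ) * powerNorm μ ψ)) := by
  rw [nehari_eq, powerNorm_ofReal_smul hμ hα, nehariQuad_smul, Complex.norm_real,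
    Real.norm_of_nonneg hα]
  ring

lemma exists_pos_rpow_eq (hμ : 0 < μ) {θ : ℝ} (hθ : 0 < θ) : ∃ α > 0, α ^ (2 * μ) = θ :=
  ⟨θ ^ (2 * μ)⁻¹, Real.rpow_pos_of_pos hθ _, Real.rpow_inv_rpow hθ.le (by positivity)⟩

lemma ofReal_smul_mem_nehariRegion (hμ : 0 ≤ μ) {α : ℝ} (hα : 0 < α) {ψ : Q} (hψ : ψ ≠ 0)
    (h : nehariQuad γ ω ψ ≤ lam * (α ^ (2 * μ) * powerNorm μ ψ)) :
    (α : ℂ) • ψ ∈ nehariRegion γ lam μ ω := by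
  refine ⟨smul_ne_zero (Complex.ofReal_ne_zero.2 hα.ne') hψ, ?_⟩
  rw [nehari_ofReal_smul hμ hα.le]
  exact mul_nonpos_of_nonneg_of_nonpos (sq_nonneg α) (sub_nonpos.2 h)

lemma rightUnit_ne_zero : rightUnit ≠ 0 := fun h => by
  have hval := rightValue_rightUnit
  rw [h, ← rightValueL_apply, map_zero] at hval
  exact zero_ne_one hval

lemma nehariRegion_nonempty (hlam : 0 < lam) (hμ : 0 < μ) :
    (nehariRegion γ lam μ ω).Nonempty := by
  have hP := powerNorm_pos hμ.le rightUnit_ne_zero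
  set θ := max 1 (nehariQuad γ ω rightUnit / (lam * powerNorm μ rightUnit))
  obtain ⟨α, hα, hαθ⟩ := exists_pos_rpow_eq hμ (zero_lt_one.trans_le (le_max_left _ _) : 0 < θ)
  refine ⟨_, ofReal_smul_mem_nehariRegion hμ.le hα rightUnit_ne_zero ?_⟩
  rw [hαθ, mul_left_comm, ← div_le_iff₀ (by positivity)]
  exact le_max_right _ _

/-- The infimum of `‖ψ‖_p^p`, `p = 2μ + 2`, over the region `I_ω ≤ 0`; a multiple of `d(ω)`. -/
def level (γ lam μ ω : ℝ) : ℝ := sInf (powerNorm μ '' nehariRegion γ lam μ ω)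

lemma bddBelow_powerNorm (γ lam μ ω : ℝ) : BddBelow (powerNorm μ '' nehariRegion γ lam μ ω) :=
  ⟨0, forall_mem_image.2 fun ψ _ => powerNorm_nonneg μ ψ⟩

lemma level_le {ψ : Q} (h : ψ ∈ nehariRegion γ lam μ ω) : level γ lam μ ω ≤ powerNorm μ ψ :=
  csInf_le (bddBelow_powerNorm γ lam μ ω) (mem_image_of_mem _ h)

lemma level_le_mul (hμ : 0 < μ) {θ : ℝ} (hθ : θ ∈ Ioc 0 1) {ψ : Q} (hψ : ψ ≠ 0)
    (h : nehariQuad γ ω ψ ≤ lam * (θ * powerNorm μ ψ)) :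
    level γ lam μ ω ≤ θ * powerNorm μ ψ := by
  obtain ⟨α, hα, rfl⟩ := exists_pos_rpow_eq hμ hθ.1
  have hα1 : α ≤ 1 := by
    rw [← Real.rpow_le_rpow_iff hα.le zero_le_one (by positivity : 0 < 2 * μ), Real.one_rpow]
    exact hθ.2
  calc level γ lam μ ω ≤ powerNorm μ ((α : ℂ) • ψ) :=
        level_le (ofReal_smul_mem_nehariRegion hμ.le hα hψ h)
    _ = α ^ (2 * μ) * α ^ 2 * powerNorm μ ψ := powerNorm_ofReal_smul hμ.le hα.le ψ
    _ ≤ α ^ (2 * μ) * powerNorm μ ψ := by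
        gcongr
        · exact powerNorm_nonneg μ ψ
        · exact mul_le_of_le_one_right hθ.1.le (pow_le_one₀ hα.le hα1)

lemma exists_level_le_mul (hlam : 0 < lam) (hμ : 0 < μ) {κ K : ℝ} (hκ : 0 < κ) (hK : 0 < K) :
    ∃ β ∈ Ioo (0 : ℝ) 1, ∀ ψ : Q, ψ ≠ 0 → powerNorm μ ψ ≤ K → nehari γ lam μ ω ψ ≤ -κ →
      level γ lam μ ω ≤ β * powerNorm μ ψ := by
  set β := max (1 / 2) (1 - κ / (lam * K))
  have hβ0 : 0 < β := one_half_pos.trans_le (le_max_left _ _)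
  have hβ1 : β < 1 := max_lt one_half_lt_one (sub_lt_self _ (by positivity))
  refine ⟨β, ⟨hβ0, hβ1⟩, fun ψ hψ hP hN => level_le_mul hμ ⟨hβ0, hβ1.le⟩ hψ ?_⟩
  have hgap : lam * (1 - β) * powerNorm μ ψ ≤ κ :=
    calc lam * (1 - β) * powerNorm μ ψ ≤ lam * (κ / (lam * K)) * K := by
          gcongr
          · exact powerNorm_nonneg μ ψ
          · exact sub_le_comm.1 (le_max_right _ _)
      _ = κ := by field_simp
  rw [nehari_eq] at hN
  linarith

lemma nehari_eq_zero_of_powerNorm_eq_level (hlam : 0 < lam) (hμ : 0 < μ) {ψ : Q}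
    (hψ : ψ ∈ nehariRegion γ lam μ ω) (hP : powerNorm μ ψ = level γ lam μ ω) :
    nehari γ lam μ ω ψ = 0 := by
  refine hψ.2.eq_of_not_lt fun hneg => ?_
  have hpos := powerNorm_pos hμ.le hψ.1
  obtain ⟨β, hβ, hle⟩ := exists_level_le_mul (γ := γ) (ω := ω) hlam hμ (neg_pos.2 hneg) hpos
  have hcontra := hle ψ hψ.1 le_rfl (neg_neg _).ge
  rw [← hP] at hcontra
  exact hcontra.not_gt (mul_lt_of_lt_one_left hpos hβ.2)

lemma Coercive.level_pos (hQ : Coercive γ ω) (hlam : 0 < lam) (hμ : 0 < μ) :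
    0 < level γ lam μ ω := by
  obtain ⟨c, hc, hcoer⟩ := hQ
  obtain ⟨r, hr, hrc⟩ := exists_pos_rpow_eq hμ (div_pos hc hlam)
  refine lt_of_lt_of_le (by positivity : 0 < c * r ^ 2 / lam)
    (le_csInf ((nehariRegion_nonempty hlam hμ).image _) (forall_mem_image.2 fun ψ hψ => ?_))
  have hψ0 : 0 < ‖ψ‖ := norm_pos_iff.2 hψ.1
  have hcP : c * ‖ψ‖ ^ 2 ≤ lam * powerNorm μ ψ := (hcoer ψ).trans (sub_nonpos.1 hψ.2)
  have hrψ : r ≤ ‖ψ‖ := by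
    rw [← Real.rpow_le_rpow_iff hr.le hψ0.le (by positivity : 0 < 2 * μ), hrc, div_le_iff₀' hlam]
    refine le_of_mul_le_mul_right (hcP.trans ?_) (pow_pos hψ0 2)
    rw [mul_assoc]
    exact mul_le_mul_of_nonneg_left (powerNorm_le hμ.le ψ) hlam.le
  rw [div_le_iff₀' hlam]
  exact (by gcongr : c * r ^ 2 ≤ c * ‖ψ‖ ^ 2).trans hcP

lemma Coercive.exists_norm_le (hQ : Coercive γ ω) (hlam : 0 < lam) {u : ℕ → Q} {L : ℝ}
    (hu : ∀ n, u n ∈ nehariRegion γ lam μ ω)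
    (hL : Tendsto (fun n => powerNorm μ (u n)) atTop (𝓝 L)) : ∃ M, ∀ n, ‖u n‖ ≤ M := by
  obtain ⟨c, hc, hcoer⟩ := hQ
  obtain ⟨B, hB⟩ := hL.bddAbove_range
  refine ⟨√(lam * B / c), fun n => Real.le_sqrt_of_sq_le ?_⟩
  rw [le_div_iff₀' hc]
  exact ((hcoer _).trans (sub_nonpos.1 (hu n).2)).trans
    (mul_le_mul_of_nonneg_left (hB ⟨n, rfl⟩) hlam.le)

/-! ### Exclusion of vanishing -/

lemma nehari_rightPart_add (hμ : 0 ≤ μ) (ψ : Q) :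
    nehari γ lam μ ω ψ.rightPart + nehari γ lam μ ω ψ.leftPart = nehari γ lam μ ω ψ +
      γ⁻¹ * (‖ψ.rightValue - ψ.leftValue‖ ^ 2 - ‖ψ.rightValue‖ ^ 2 - ‖ψ.leftValue‖ ^ 2) := by
  simp only [nehari, quadForm, mass, rightValue_rightPart, leftValue_rightPart,
    rightValue_leftPart, leftValue_leftPart, sub_zero, zero_sub, norm_neg]
  rw [← norm_fn_rightPart_sq_add ψ, ← norm_dfn_rightPart_sq_add ψ, ← powerNorm_rightPart_add hμ ψ]
  ring

lemma nehari_transl {ψ : Q} (hr : ψ.rightValue = 0) (hl : ψ.leftValue = 0) {t : ℝ} (ht : t ≠ 0) :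
    nehari γ lam μ ω (ψ.transl hr hl t) = nehari γ lam μ ω ψ := by
  have hfn : ‖(ψ.transl hr hl t).fn‖ = ‖ψ.fn‖ := (translL2 t).norm_map ψ.fn
  have hdfn : ‖(ψ.transl hr hl t).dfn‖ = ‖ψ.dfn‖ := (translL2 t).norm_map ψ.dfn
  rw [nehari, nehari, quadForm, quadForm, mass, mass, hfn, hdfn, powerNorm_transl,
    rightValue_transl hr hl ht, leftValue_transl hr hl ht, hr, hl, sub_self, sub_self]

/-- The competitor is one of the two halves of the translate of `w` that moves `t` to the origin:
each of them has a jump there, which costs `-γ⁻¹ |w(t)|²`. -/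
lemma exists_competitor (hμ : 0 ≤ μ) {w : Q} (hr : w.rightValue = 0) (hl : w.leftValue = 0)
    {t : ℝ} (ht : t ≠ 0) (hwt : evalL t w ≠ 0) :
    ∃ v : Q, v ≠ 0 ∧ powerNorm μ v ≤ powerNorm μ w ∧
      nehari γ lam μ ω v ≤ nehari γ lam μ ω w / 2 - γ⁻¹ * ‖evalL t w‖ ^ 2 := by
  set z := w.transl hr hl t
  have hzr : z.rightValue = evalL t w := rightValue_transl hr hl ht
  have hzl : z.leftValue = evalL t w := leftValue_transl hr hl ht
  have hP : powerNorm μ z.rightPart + powerNorm μ z.leftPart = powerNorm μ w :=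
    (powerNorm_rightPart_add hμ z).trans (powerNorm_transl μ hr hl t)
  have hN : nehari γ lam μ ω z.rightPart + nehari γ lam μ ω z.leftPart =
      nehari γ lam μ ω w - 2 * (γ⁻¹ * ‖evalL t w‖ ^ 2) := by
    rw [nehari_rightPart_add hμ, nehari_transl hr hl ht, hzr, hzl, sub_self, norm_zero]
    ring
  have hright : z.rightPart ≠ 0 := fun h => hwt <| by
    rw [← hzr, ← rightValue_rightPart, h, ← rightValueL_apply, map_zero]
  have hleft : z.leftPart ≠ 0 := fun h => hwt <| by
    rw [← hzl, ← leftValue_leftPart, h, ← leftValueL_apply, map_zero]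
  rcases le_total (nehari γ lam μ ω z.rightPart) (nehari γ lam μ ω z.leftPart) with h | h
  · exact ⟨z.rightPart, hright, by linarith [powerNorm_nonneg μ z.leftPart], by linarith⟩
  · exact ⟨z.leftPart, hleft, by linarith [powerNorm_nonneg μ z.rightPart], by linarith⟩

lemma exists_forall_le_norm_evalL (hμ : 0 < μ) {η : ℝ} (hη : 0 < η) (M : ℝ) :
    ∃ δ > 0, ∀ w : Q, ‖w‖ ≤ M → η ≤ powerNorm μ w → ∃ t ≠ 0, δ ≤ ‖evalL t w‖ := by
  obtain ⟨δ, hδ, hδη⟩ := exists_pos_rpow_eq hμ (by positivity : 0 < η / (M ^ 2 + 1))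
  refine ⟨δ, hδ, fun w hw hP => ?_⟩
  by_contra! hlt
  have hae : ∀ᵐ x : ℝ, ‖w.fn x‖ ≤ δ := by
    filter_upwards [ae_eq_evalL w, volume.ae_ne 0] with x hx h0
    exact hx ▸ (hlt x h0).le
  refine hP.not_gt ?_
  calc powerNorm μ w ≤ δ ^ (2 * μ) * ‖w.fn‖ ^ 2 := powerNorm_le_of_ae_norm_le hμ.le hae
    _ ≤ η / (M ^ 2 + 1) * M ^ 2 := by
        rw [hδη]
        gcongr
        exact w.norm_fn_le.trans hw
    _ < η := by
        rw [div_mul_eq_mul_div, div_lt_iff₀ (by positivity)]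
        exact mul_lt_mul_of_pos_left (lt_add_one _) hη

lemma exists_level_le_mul_of_boundaryValues_eq_zero (hγ : 0 < γ) (hlam : 0 < lam) (hμ : 0 < μ)
    {η : ℝ} (hη : 0 < η) (M : ℝ) :
    ∃ β < 1, ∃ ε > 0, ∀ w : Q, w.rightValue = 0 → w.leftValue = 0 → ‖w‖ ≤ M →
      η ≤ powerNorm μ w → nehari γ lam μ ω w ≤ ε → level γ lam μ ω ≤ β * powerNorm μ w := by
  obtain ⟨δ, hδ, hlarge⟩ := exists_forall_le_norm_evalL hμ hη M
  obtain ⟨β, hβ, hlevel⟩ := exists_level_le_mul (γ := γ) (ω := ω) hlam hμ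
    (by positivity : 0 < γ⁻¹ * δ ^ 2 / 2) (by positivity : 0 < |M| ^ (2 * μ) * |M| ^ 2 + 1)
  refine ⟨β, hβ.2, γ⁻¹ * δ ^ 2, by positivity, fun w hr hl hw hP hN => ?_⟩
  obtain ⟨t, ht, hδt⟩ := hlarge w hw hP
  obtain ⟨v, hv, hvP, hvN⟩ := exists_competitor (γ := γ) (lam := lam) (ω := ω) hμ.le hr hl ht
    (norm_pos_iff.1 (hδ.trans_le hδt))
  have hjump : γ⁻¹ * δ ^ 2 ≤ γ⁻¹ * ‖evalL t w‖ ^ 2 := by gcongr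
  have hwP : powerNorm μ w ≤ |M| ^ (2 * μ) * |M| ^ 2 :=
    (powerNorm_le hμ.le w).trans (by gcongr <;> exact hw.trans (le_abs_self M))
  exact (hlevel v hv (by linarith) (by linarith)).trans (mul_le_mul_of_nonneg_left hvP hβ.1.le)

/-- The projection of `Q` onto the functions with vanishing boundary values that subtracts
`ψ(0+) e^{-x}` on the right half-line and `ψ(0-) e^{x}` on the left one. -/
def removeBoundary : Q →L[ℂ] Q :=
  .id ℂ Q - (rightValueL.smulRight rightUnit + leftValueL.smulRight leftUnit)

lemma removeBoundary_apply (ψ : Q) :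
    removeBoundary ψ = ψ - (rightValueL ψ • rightUnit + leftValueL ψ • leftUnit) := rfl

lemma rightValue_removeBoundary (ψ : Q) : (removeBoundary ψ).rightValue = 0 := by
  rw [← rightValueL_apply, removeBoundary_apply, map_sub, map_add, map_smul, map_smul,
    rightValueL_apply rightUnit, rightValueL_apply leftUnit, rightValue_rightUnit,
    rightValue_leftUnit, smul_zero, add_zero, smul_eq_mul, mul_one, sub_self]

lemma leftValue_removeBoundary (ψ : Q) : (removeBoundary ψ).leftValue = 0 := by
  rw [← leftValueL_apply, removeBoundary_apply, map_sub, map_add, map_smul, map_smul,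
    leftValueL_apply rightUnit, leftValueL_apply leftUnit, leftValue_rightUnit,
    leftValue_leftUnit, smul_zero, zero_add, smul_eq_mul, mul_one, sub_self]

lemma WeaklyTendsto.tendsto_removeBoundary_sub {u : ℕ → Q} (h : WeaklyTendsto u 0) :
    Tendsto (fun n => removeBoundary (u n) - u n) atTop (𝓝 0) := by
  have hlim := (((h rightValueL).smul_const rightUnit).add
    ((h leftValueL).smul_const leftUnit)).neg
  simp only [map_zero, zero_smul, add_zero, neg_zero] at hlim
  refine hlim.congr fun n => ?_
  rw [removeBoundary_apply, sub_sub_cancel_left]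

lemma not_weaklyTendsto_zero (hγ : 0 < γ) (hlam : 0 < lam) (hμ : 0 < μ) (hQ : Coercive γ ω)
    {u : ℕ → Q} (hu : ∀ n, u n ∈ nehariRegion γ lam μ ω)
    (hL : Tendsto (fun n => powerNorm μ (u n)) atTop (𝓝 (level γ lam μ ω))) :
    ¬ WeaklyTendsto u 0 := by
  intro hweak
  have hpos : 0 < level γ lam μ ω := hQ.level_pos hlam hμ
  obtain ⟨M₀, hM₀⟩ := hQ.exists_norm_le hlam hu hL
  set w : ℕ → Q := fun n => removeBoundary (u n)
  set M := max M₀ (‖removeBoundary‖ * M₀)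
  have huM : ∀ n, ‖u n‖ ≤ M := fun n => (hM₀ n).trans (le_max_left _ _)
  have hwM : ∀ n, ‖w n‖ ≤ M := fun n =>
    (removeBoundary.le_opNorm_of_le (hM₀ n)).trans (le_max_right _ _)
  have hwu : Tendsto (fun n => w n - u n) atTop (𝓝 0) := hweak.tendsto_removeBoundary_sub
  have hPw : Tendsto (fun n => powerNorm μ (w n)) atTop (𝓝 (level γ lam μ ω)) := by
    simpa only [sub_add_cancel, zero_add] using (tendsto_powerNorm_sub hμ.le huM hwM hwu).add hL
  obtain ⟨β, hβ, ε, hε, hlevel⟩ :=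
    exists_level_le_mul_of_boundaryValues_eq_zero (ω := ω) hγ hlam hμ (half_pos hpos) M
  have hev : ∀ᶠ n in atTop, level γ lam μ ω ≤ β * powerNorm μ (w n) := by
    filter_upwards [hPw.eventually_const_lt (half_lt_self hpos),
      (tendsto_nehari_sub (γ := γ) (lam := lam) (ω := ω) hμ.le huM hwM hwu).eventually_lt_const hε]
      with n hP hN
    refine hlevel (w n) (rightValue_removeBoundary _) (leftValue_removeBoundary _) (hwM n) hP.le ?_
    linarith [(hu n).2]
  exact (ge_of_tendsto (hPw.const_mul β) hev).not_gt (mul_lt_of_lt_one_left hpos hβ)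

/-! ### Compactness of minimizing sequences -/

lemma WeaklyTendsto.mem_nehariRegion (hγ : 0 < γ) (hlam : 0 < lam) (hμ : 0 < μ)
    (hQ : Coercive γ ω) {u : ℕ → Q} {ψ : Q} (hweak : WeaklyTendsto u ψ)
    (hu : ∀ n, u n ∈ nehariRegion γ lam μ ω)
    (hL : Tendsto (fun n => powerNorm μ (u n)) atTop (𝓝 (level γ lam μ ω))) :
    ψ ∈ nehariRegion γ lam μ ω ∧ powerNorm μ ψ = level γ lam μ ω := by
  have hψ : ψ ≠ 0 := fun h => not_weaklyTendsto_zero hγ hlam hμ hQ hu hL (h ▸ hweak)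
  obtain ⟨M, hM⟩ := hQ.exists_norm_le hlam hu hL
  have hrest : Tendsto (fun n => powerNorm μ (u n - ψ)) atTop
      (𝓝 (level γ lam μ ω - powerNorm μ ψ)) := by
    have hlim := (hL.sub_const (powerNorm μ ψ)).sub (tendsto_powerNorm_split hμ.le hM hweak)
    rw [sub_zero] at hlim
    exact hlim.congr fun n => by ring
  have hle : powerNorm μ ψ ≤ level γ lam μ ω :=
    sub_nonneg.1 (ge_of_tendsto' hrest fun n => powerNorm_nonneg μ (u n - ψ))
  -- If `I_ω(ψ) > 0`, the remainders `u n - ψ` end up in the region, with too small a power norm.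
  have hmem : ψ ∈ nehariRegion γ lam μ ω := by
    refine ⟨hψ, ?_⟩
    by_contra! hpos
    have hev : ∀ᶠ n in atTop, level γ lam μ ω ≤ powerNorm μ (u n - ψ) := by
      filter_upwards [(tendsto_nehari_split hμ.le hM hweak).eventually_const_lt
        (neg_lt_zero.2 hpos)] with n hn
      have hneg : nehari γ lam μ ω (u n - ψ) < 0 := by linarith [(hu n).2]
      exact level_le ⟨fun h0 => hpos.not_ge (sub_eq_zero.1 h0 ▸ (hu n).2), hneg.le⟩
    linarith [ge_of_tendsto hrest hev, powerNorm_pos hμ.le hψ]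
  exact ⟨hmem, hle.antisymm (level_le hmem)⟩

lemma Coercive.tendsto_of_weaklyTendsto (hQ : Coercive γ ω) {u : ℕ → Q} {ψ : Q}
    (hweak : WeaklyTendsto u ψ) (hu : ∀ n, nehari γ lam μ ω (u n) ≤ 0)
    (hψ : nehari γ lam μ ω ψ = 0)
    (hP : Tendsto (fun n => powerNorm μ (u n)) atTop (𝓝 (powerNorm μ ψ))) :
    Tendsto u atTop (𝓝 ψ) := by
  obtain ⟨c, hc, hcoer⟩ := hQ
  have hlim := (((hP.sub_const (powerNorm μ ψ)).const_mul lam).sub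
    (tendsto_nehariQuad_split γ ω hweak)).const_mul c⁻¹
  rw [sub_self, mul_zero, sub_zero, mul_zero] at hlim
  have hsq : Tendsto (fun n => ‖u n - ψ‖ ^ 2) atTop (𝓝 0) := by
    refine squeeze_zero (fun n => sq_nonneg _) (fun n => ?_) hlim
    rw [← div_eq_inv_mul, le_div_iff₀' hc]
    have hun := hu n
    rw [nehari_eq] at hun hψ
    linarith [hcoer (u n - ψ)]
  rw [tendsto_iff_norm_sub_tendsto_zero]
  simpa only [Real.sqrt_sq (norm_nonneg _), Real.sqrt_zero] using hsq.sqrt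

lemma tendsto_of_tendsto_level (hγ : 0 < γ) (hlam : 0 < lam) (hμ : 0 < μ) (hQ : Coercive γ ω)
    {u : ℕ → Q} {ψ : Q} (hweak : WeaklyTendsto u ψ) (hu : ∀ n, u n ∈ nehariRegion γ lam μ ω)
    (hL : Tendsto (fun n => powerNorm μ (u n)) atTop (𝓝 (level γ lam μ ω))) :
    Tendsto u atTop (𝓝 ψ) := by
  obtain ⟨hψ, hP⟩ := hweak.mem_nehariRegion hγ hlam hμ hQ hu hL
  exact hQ.tendsto_of_weaklyTendsto hweak (fun n => (hu n).2)
    (nehari_eq_zero_of_powerNorm_eq_level hlam hμ hψ hP) (hP ▸ hL)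

lemma exists_powerNorm_eq_level (hγ : 0 < γ) (hlam : 0 < lam) (hμ : 0 < μ) (hQ : Coercive γ ω) :
    ∃ ψ ∈ nehariManifold γ lam μ ω, powerNorm μ ψ = level γ lam μ ω := by
  obtain ⟨s, -, hs, hmem⟩ := exists_seq_tendsto_sInf
    ((nehariRegion_nonempty (γ := γ) (ω := ω) hlam hμ).image (powerNorm μ))
    (bddBelow_powerNorm γ lam μ ω)
  choose u hu hus using hmem
  have hL : Tendsto (fun n => powerNorm μ (u n)) atTop (𝓝 (level γ lam μ ω)) := by
    simpa only [hus, level] using hs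
  obtain ⟨M, hM⟩ := hQ.exists_norm_le hlam hu hL
  obtain ⟨ψ, k, hk, hweak⟩ := exists_weaklyTendsto_subseq hM
  obtain ⟨hψ, hP⟩ := hweak.mem_nehariRegion hγ hlam hμ hQ (fun n => hu (k n))
    (hL.comp hk.tendsto_atTop)
  exact ⟨ψ, ⟨hψ.1, nehari_eq_zero_of_powerNorm_eq_level hlam hμ hψ hP⟩, hP⟩

/-! ### The action and the reduced action -/

lemma action_eq_reducedAction (hμ : 0 < μ) {ψ : Q} (hψ : ψ ∈ nehariManifold γ lam μ ω) :
    action γ lam μ ω ψ = reducedAction lam μ ψ := by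
  have hN : quadForm γ ψ + ω * mass ψ = lam * powerNorm μ ψ := sub_eq_zero.1 hψ.2
  calc action γ lam μ ω ψ
      = 1 / 2 * (quadForm γ ψ + ω * mass ψ) - lam / (2 * μ + 2) * powerNorm μ ψ := by
        rw [action, energy]
        ring
    _ = reducedAction lam μ ψ := by
        rw [hN, reducedAction]
        field_simp
        ring

lemma isLeast_reducedAction (hlam : 0 < lam) (hμ : 0 < μ) {ψ : Q}
    (hψ : ψ ∈ nehariManifold γ lam μ ω) (hP : powerNorm μ ψ = level γ lam μ ω) :
    IsLeast (reducedAction lam μ '' nehariRegion γ lam μ ω) (reducedAction lam μ ψ) :=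
  ⟨mem_image_of_mem _ (nehariManifold_subset _ _ _ _ hψ), forall_mem_image.2 fun _ hφ =>
    mul_le_mul_of_nonneg_left (hP.trans_le (level_le hφ)) (by positivity)⟩

lemma isLeast_action (hlam : 0 < lam) (hμ : 0 < μ) {ψ : Q}
    (hψ : ψ ∈ nehariManifold γ lam μ ω) (hP : powerNorm μ ψ = level γ lam μ ω) :
    IsLeast (action γ lam μ ω '' nehariManifold γ lam μ ω) (action γ lam μ ω ψ) := by
  refine ⟨mem_image_of_mem _ hψ, forall_mem_image.2 fun φ hφ => ?_⟩
  rw [action_eq_reducedAction hμ hψ, action_eq_reducedAction hμ hφ]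
  exact (isLeast_reducedAction hlam hμ hψ hP).2
    (mem_image_of_mem _ (nehariManifold_subset _ _ _ _ hφ))

lemma IsMinimizingSeq.tendsto {J : Q → ℝ} {A : Set Q} {u : ℕ → Q} {m : ℝ}
    (h : IsMinimizingSeq J A u) (hm : IsLeast (J '' A) m) :
    Tendsto (fun n => J (u n)) atTop (𝓝 m) := by
  obtain ⟨-, m', hm', hlim⟩ := h
  rwa [hm.isGLB.unique hm']

lemma tendsto_powerNorm_of_tendsto_reducedAction (hlam : 0 < lam) (hμ : 0 < μ) {u : ℕ → Q} {ψ : Q}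
    (h : Tendsto (fun n => reducedAction lam μ (u n)) atTop (𝓝 (reducedAction lam μ ψ))) :
    Tendsto (fun n => powerNorm μ (u n)) atTop (𝓝 (powerNorm μ ψ)) := by
  have hk : lam * μ / (2 * (μ + 1)) ≠ 0 := by positivity
  simpa only [reducedAction, inv_mul_cancel_left₀ hk] using
    h.const_mul (lam * μ / (2 * (μ + 1)))⁻¹

end DeltaPrime

end

theorem theorem4p1 (γ lam μ ω : ℝ) (hγ : 0 < γ) (hlam : 0 < lam) (hμ : 0 < μ)
    (hω : 4 / γ ^ 2 < ω) :
    (∃ ψ : DeltaPrime.Q, ψ ≠ 0 ∧ DeltaPrime.nehari γ lam μ ω ψ = 0 ∧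
      DeltaPrime.action γ lam μ ω ψ = DeltaPrime.d γ lam μ ω ∧
      IsLeast (DeltaPrime.action γ lam μ ω '' DeltaPrime.nehariManifold γ lam μ ω)
        (DeltaPrime.action γ lam μ ω ψ) ∧
      IsLeast (DeltaPrime.reducedAction lam μ '' DeltaPrime.nehariRegion γ lam μ ω)
        (DeltaPrime.reducedAction lam μ ψ)) ∧
    (∀ (u : ℕ → DeltaPrime.Q) (ψ : DeltaPrime.Q),
      DeltaPrime.IsMinimizingSeq (DeltaPrime.action γ lam μ ω)
        (DeltaPrime.nehariManifold γ lam μ ω) u →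
      DeltaPrime.WeaklyTendsto u ψ → Tendsto u atTop (𝓝 ψ)) ∧
    (∀ (u : ℕ → DeltaPrime.Q) (ψ : DeltaPrime.Q),
      DeltaPrime.IsMinimizingSeq (DeltaPrime.reducedAction lam μ)
        (DeltaPrime.nehariRegion γ lam μ ω) u →
      DeltaPrime.WeaklyTendsto u ψ → Tendsto u atTop (𝓝 ψ)) := by
  open DeltaPrime in
  have hQ : Coercive γ ω := coercive_of_lt hγ hω
  obtain ⟨ψ₀, hψ₀, hP₀⟩ := exists_powerNorm_eq_level hγ hlam hμ hQ
  have hleast := isLeast_action hlam hμ hψ₀ hP₀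
  have hleast' := isLeast_reducedAction hlam hμ hψ₀ hP₀
  have hstrong : ∀ (u : ℕ → Q) (ψ : Q), (∀ n, u n ∈ nehariRegion γ lam μ ω) →
      Tendsto (fun n => reducedAction lam μ (u n)) atTop (𝓝 (reducedAction lam μ ψ₀)) →
      WeaklyTendsto u ψ → Tendsto u atTop (𝓝 ψ) := fun u ψ hu hlim hweak =>
    tendsto_of_tendsto_level hγ hlam hμ hQ hweak hu
      (hP₀ ▸ tendsto_powerNorm_of_tendsto_reducedAction hlam hμ hlim)
  refine ⟨⟨ψ₀, hψ₀.1, hψ₀.2, hleast.csInf_eq.symm, hleast, hleast'⟩, fun u ψ h => ?_,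
    fun u ψ h => hstrong u ψ h.1 (h.tendsto hleast')⟩
  refine hstrong u ψ (fun n => nehariManifold_subset _ _ _ _ (h.1 n)) ?_
  rw [← action_eq_reducedAction hμ hψ₀]
  exact (h.tendsto hleast).congr fun n => action_eq_reducedAction hμ (h.1 n)
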